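/- Let $d,n\ge 1$ be integers and let $\mathbb B_d$ be the open unit ball of $\mathbb C^d$. Let $H^2_d$ be the Drury–Arveson space, the reproducing kernel Hilbert space on $\mathbb B_d$ with kernel $1/(1-\langle z,w\rangle)$, and let $\mathcal M_d\subset B(H^2_d)$ be its multiplier algebra, each multiplier $f$ being identified with the multiplication operator $M_f$. Let $$\mathbb P_{d,n}=\{P\in B(H^2_d) : P=P^2=P^*,\ P M_f^*P=M_f^*P \text{ for all } f\in\mathcal M_d,\ \dim PH^2_d=n\}$$ with the norm topology. A *Banach bundle* over a space $X$ is a continuous open surjection $\pi$ from a Hausdorff space onto $X$ whose fibres are complex Banach spaces, such that the norm, the addition (of pairs in the same fibre) and the multiplication by each scalar are continuous on the total space, and such that $b_i\to 0_x$ whenever $\|b_i\|\to0$ and $\pi(b_i)\to x$. It is a *Banach algebra bundle* if the fibres are Banach algebras and multiplication is continuous. A *Hilbert bundle of rank $n$* is a Banach bundle whose fibres are Hilbert spaces and which is locally trivial with model fibre $\mathbb C^n$, through fibrewise unitary trivializations. Then the following hold. 1. The tautological bundle $\mathcal E_{d,n}=\bigsqcup_{P\in\mathbb P_{d,n}} PH^2_d$,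 topologized as a subspace of $\mathbb P_{d,n}\times H^2_d$, is a Hilbert bundle of rank $n$ over $\mathbb P_{d,n}$. 2. On $\mathfrak M_{d,n}=\bigsqcup_{P\in\mathbb P_{d,n}} P\mathcal M_d|_{PH^2_d}$, where the fibres carry the operator norm of $B(PH^2_d)$, there is exactly one topology that makes it a Banach bundle over $\mathbb P_{d,n}$ for which all sections $\gamma_f(P)=PM_f|_{PH^2_d}$, $f\in\mathcal M_d$, are continuous. With this topology $\mathfrak M_{d,n}$ is a Banach algebra bundle. 3. For every $m\in\mathbb N$ the same holds for $M_m(\mathfrak M_{d,n})=\bigsqcup_{P} (I_m\otimes P)M_m(\mathcal M_d)|_{\mathbb C^m\otimes PH^2_d}$, with the operator norm of $B(\mathbb C^m\otimes PH^2_d)$ on the fibres and with the sections given by the elements of $M_m(\mathcal M_d)$. The continuous sections of $M_m(\mathfrak M_{d,n})$ are exactly the $m\times m$ matrices of continuous sections of $\mathfrak M_{d,n}$. 4. Let $\Gamma_b$ be the set of all bounded continuous sections of $\mathfrak M_{d,n}$ with the norm $\|x\|=\sup_P\|x(P)\|$. It is an algebra under the pointwise operations, it contains every $\gamma_f$, and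 $M_m(\Gamma_b)$ is the space of bounded continuous sections of $M_m(\mathfrak M_{d,n})$. With the supremum norms on the spaces $M_m(\Gamma_b)$, $m\in\mathbb N$, the algebra $\Gamma_b$ is an operator algebra: it is complete, it satisfies Ruan's axioms $\|X\oplus Y\|=\max(\|X\|,\|Y\|)$ and $\|\alpha X\beta\|\le\|\alpha\|\|X\|\|\beta\|$ (for scalar matrices $\alpha,\beta$), the matrix multiplication of $M_m(\Gamma_b)$ is contractive for every $m$, and its unit has norm $1$; and it is completely isometrically isomorphic, as a unital algebra, to a norm-closed algebra of bounded operators on a Hilbert space. -/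

import Mathlib

/-! ## The Drury–Arveson space -/

open scoped ComplexOrder in
/-- Entrywise powers of Gram matrices are positive semidefinite. -/
theorem inner_pow_posSemidef {𝕜 ι E : Type*} [RCLike 𝕜] [NormedAddCommGroup E]
    [InnerProductSpace 𝕜 E] [Finite ι] (v : ι → E) (m : ℕ) :
    (Matrix.of fun i j => (inner 𝕜 (v i) (v j) : 𝕜) ^ m).PosSemidef := by
  have := Fintype.ofFinite ι
  induction m with
  | zero =>
    convert Matrix.posSemidef_vecMulVec_self_star (R := 𝕜) (fun _ : ι => (1 : 𝕜)) using 1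
    ext i j
    simp [Matrix.vecMulVec]
  | succ m ih =>
    convert ih.hadamard (Matrix.posSemidef_gram 𝕜 v) using 1
    ext i j
    simp [pow_succ]

/-- The open unit ball of `ℂ^d`. -/
abbrev unitBall (d : ℕ) : Set (EuclideanSpace ℂ (Fin d)) :=
  Metric.ball (0 : EuclideanSpace ℂ (Fin d)) 1

/-- The kernel `k(z, w) = 1 / (1 - ⟨z, w⟩)` on the unit ball of `ℂ^d`, where `⟨z, w⟩` is linear
in `z` (so it is `inner ℂ w z` in Mathlib's convention), seen as an operator on `ℂ`. -/
noncomputable def druryArvesonKernel (d : ℕ) :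
    Matrix (unitBall d) (unitBall d) (ℂ →L[ℂ] ℂ) :=
  Matrix.of fun z w =>
    (1 - inner ℂ (w : EuclideanSpace ℂ (Fin d)) (z : EuclideanSpace ℂ (Fin d)))⁻¹ •
      ContinuousLinearMap.id ℂ ℂ

open scoped ComplexOrder in
theorem druryArvesonKernel_posSemidef (d : ℕ) : (druryArvesonKernel d).PosSemidef := by
  have key := (RKHS.posSemidef_tfae (K := druryArvesonKernel d)).out 0 2
  refine key.mpr ⟨?_, fun x => ?_⟩
  · ext i j
    have h : star (ContinuousLinearMap.id ℂ ℂ) = ContinuousLinearMap.id ℂ ℂ :=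
      star_one (ℂ →L[ℂ] ℂ)
    simp [druryArvesonKernel, Matrix.conjTranspose_apply, star_smul, h]
  · have hs : HasSum (fun m : ℕ => ∑ i ∈ x.support, ∑ j ∈ x.support,
        star (x i) * (inner ℂ (j : EuclideanSpace ℂ (Fin d))
          (i : EuclideanSpace ℂ (Fin d)) : ℂ) ^ m * x j)
        (x.sum fun i a => x.sum fun j b => inner ℂ (druryArvesonKernel d j i a) b) := by
      refine hasSum_sum fun i _ => hasSum_sum fun j _ => ?_
      have h1 : ‖(inner ℂ (j : EuclideanSpace ℂ (Fin d))
          (i : EuclideanSpace ℂ (Fin d)) : ℂ)‖ < 1 := by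
        have hi := mem_ball_zero_iff.mp i.2
        have hj := mem_ball_zero_iff.mp j.2
        calc _ ≤ ‖(j : EuclideanSpace ℂ (Fin d))‖ * ‖(i : EuclideanSpace ℂ (Fin d))‖ :=
              norm_inner_le_norm _ _
          _ < 1 := by
            nlinarith [norm_nonneg (j : EuclideanSpace ℂ (Fin d)),
              norm_nonneg (i : EuclideanSpace ℂ (Fin d))]
      have h2 : inner ℂ (druryArvesonKernel d j i (x i)) (x j) = star (x i) *
          (1 - inner ℂ (j : EuclideanSpace ℂ (Fin d)) (i : EuclideanSpace ℂ (Fin d)))⁻¹ *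
            x j := by
        simp [druryArvesonKernel]
        ring
      simp only [h2]
      exact ((hasSum_geometric_of_norm_lt_one h1).mul_left (star (x i))).mul_right (x j)
    refine (Complex.hasSum_re hs).nonneg fun m => ?_
    have hp := (inner_pow_posSemidef (𝕜 := ℂ) (fun i : x.support =>
      (i.1 : EuclideanSpace ℂ (Fin d))) m).transpose.dotProduct_mulVec_nonneg (fun i => x i)
    have h3 := (RCLike.nonneg_iff.mp hp).1
    have e : (∑ i ∈ x.support, ∑ j ∈ x.support,
        star (x i) * (inner ℂ (j : EuclideanSpace ℂ (Fin d))
          (i : EuclideanSpace ℂ (Fin d)) : ℂ) ^ m * x j) =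
        (star fun i : x.support => x ↑i) ⬝ᵥ (Matrix.of fun i j : x.support =>
          (inner ℂ (i.1 : EuclideanSpace ℂ (Fin d))
            (j.1 : EuclideanSpace ℂ (Fin d)) : ℂ) ^ m).transpose.mulVec fun i => x ↑i := by
      simp [dotProduct, Matrix.mulVec, Finset.mul_sum, ← Finset.sum_coe_sort x.support, mul_assoc]
    rw [e]
    exact h3

instance (d : ℕ) : Fact (druryArvesonKernel d).PosSemidef := ⟨druryArvesonKernel_posSemidef d⟩

/-- The Drury–Arveson space `H²_d`: the reproducing kernel Hilbert space of functions on the unit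
ball of `ℂ^d` with kernel `1 / (1 - ⟨z, w⟩)`. -/
def DruryArveson (d : ℕ) : Type := RKHS.OfKernel (druryArvesonKernel d)

namespace DruryArveson

noncomputable instance (d : ℕ) : NormedAddCommGroup (DruryArveson d) :=
  inferInstanceAs (NormedAddCommGroup (RKHS.OfKernel (druryArvesonKernel d)))

noncomputable instance (d : ℕ) : InnerProductSpace ℂ (DruryArveson d) :=
  inferInstanceAs (InnerProductSpace ℂ (RKHS.OfKernel (druryArvesonKernel d)))

instance (d : ℕ) : CompleteSpace (DruryArveson d) :=
  inferInstanceAs (CompleteSpace (RKHS.OfKernel (druryArvesonKernel d)))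

noncomputable instance (d : ℕ) : RKHS ℂ (DruryArveson d) (unitBall d) ℂ :=
  inferInstanceAs (RKHS ℂ (RKHS.OfKernel (druryArvesonKernel d)) (unitBall d) ℂ)

theorem kernel_eq (d : ℕ) : RKHS.kernel (DruryArveson d) = druryArvesonKernel d :=
  RKHS.OfKernel.kernel_ofKernel (K := druryArvesonKernel d)

end DruryArveson

/-- The multiplier algebra `𝓜_d`, as the algebra of all bounded multiplication operators
`M_φ : h ↦ φ h` on `H²_d`; its norm is the multiplier norm. -/
def multiplierAlgebra (d : ℕ) : Subalgebra ℂ (DruryArveson d →L[ℂ] DruryArveson d) where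
  carrier := {T | ∃ φ : unitBall d → ℂ, ∀ (h : DruryArveson d) (z : unitBall d),
    (T h) z = φ z * h z}
  mul_mem' := by
    rintro S T ⟨φ, hφ⟩ ⟨ψ, hψ⟩
    exact ⟨fun z => φ z * ψ z, fun h z => by
      change (S (T h)) z = _
      rw [hφ, hψ, mul_assoc]⟩
  add_mem' := by
    rintro S T ⟨φ, hφ⟩ ⟨ψ, hψ⟩
    exact ⟨fun z => φ z + ψ z, fun h z => by
      change (S h + T h) z = _
      rw [RKHS.coe_add, Pi.add_apply, hφ, hψ, add_mul]⟩
  algebraMap_mem' := fun c => ⟨fun _ => c, fun h z => by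
    rw [ContinuousLinearMap.algebraMap_apply, RKHS.coe_smul, Pi.smul_apply, smul_eq_mul]⟩

/-! ## The Grassmannian of multiplier-coinvariant subspaces -/

/-- `ℙ_{d,n}`: the orthogonal projections of `H²_d` onto `n`-dimensional subspaces that are
invariant under the adjoints of all multiplication operators. As a subtype of the bounded
operators it carries the norm topology. -/
def coinvariantGrassmannian (d n : ℕ) : Set (DruryArveson d →L[ℂ] DruryArveson d) :=
  {P | P * P = P ∧ ContinuousLinearMap.adjoint P = P ∧
    (∀ T ∈ multiplierAlgebra d,
      P * ContinuousLinearMap.adjoint T * P = ContinuousLinearMap.adjoint T * P) ∧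
    Module.rank ℂ (LinearMap.range (P : DruryArveson d →ₗ[ℂ] DruryArveson d)) = n}

/-- The fibre `P H²_d` of the tautological bundle `𝓔_{d,n}` at `P`. -/
abbrev TautologicalFibre {d n : ℕ} (P : coinvariantGrassmannian d n) : Type :=
  LinearMap.range (P.1 : DruryArveson d →ₗ[ℂ] DruryArveson d)

/-- The compression `P T|_{P H²_d}` of an operator `T` on `H²_d`. -/
noncomputable def compression {d n : ℕ} (P : coinvariantGrassmannian d n)
    (T : DruryArveson d →L[ℂ] DruryArveson d) : TautologicalFibre P →L[ℂ] TautologicalFibre P :=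
  (P.1.codRestrict (LinearMap.range (P.1 : DruryArveson d →ₗ[ℂ] DruryArveson d))
    fun h => ⟨h, rfl⟩) ∘L T ∘L (LinearMap.range (P.1 : DruryArveson d →ₗ[ℂ] DruryArveson d)).subtypeL

theorem coe_compression {d n : ℕ} (P : coinvariantGrassmannian d n)
    (T : DruryArveson d →L[ℂ] DruryArveson d) (v : TautologicalFibre P) :
    ((compression P T v : TautologicalFibre P) : DruryArveson d) = P.1 (T v) := rfl

/-- An element of `P H²_d` is fixed by `P`. -/
theorem proj_apply_fibre {d n : ℕ} (P : coinvariantGrassmannian d n) (v : TautologicalFibre P) :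
    P.1 (v : DruryArveson d) = v := by
  obtain ⟨_, w, rfl⟩ := v
  exact congrArg (fun S : DruryArveson d →L[ℂ] DruryArveson d => S w) P.2.1

/-- Coinvariance: `P T P = P T` for every multiplication operator `T`. -/
theorem proj_mul_proj {d n : ℕ} (P : coinvariantGrassmannian d n)
    {T : DruryArveson d →L[ℂ] DruryArveson d} (hT : T ∈ multiplierAlgebra d) :
    P.1 * T * P.1 = P.1 * T := by
  have hsa : star P.1 = P.1 := P.2.2.1
  have h : P.1 * star T * P.1 = star T * P.1 := P.2.2.2.1 T hT
  have h' := congrArg star h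
  simpa [hsa, mul_assoc] using h'

/-- Compression to `P H²_d` as a unital homomorphism on the multiplier algebra. -/
noncomputable def compressionHom {d n : ℕ} (P : coinvariantGrassmannian d n) :
    multiplierAlgebra d →ₐ[ℂ] (TautologicalFibre P →L[ℂ] TautologicalFibre P) where
  toFun T := compression P T
  map_one' := by
    refine ContinuousLinearMap.ext fun v => Subtype.ext ?_
    exact proj_apply_fibre P v
  map_mul' S T := by
    refine ContinuousLinearMap.ext fun v => Subtype.ext ?_
    have h := congrArg (fun R : DruryArveson d →L[ℂ] DruryArveson d => R (T.1 v))
      (proj_mul_proj P S.2)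
    exact h.symm
  map_zero' := by
    refine ContinuousLinearMap.ext fun v => Subtype.ext ?_
    exact map_zero P.1
  map_add' S T := by
    refine ContinuousLinearMap.ext fun v => Subtype.ext ?_
    exact map_add P.1 _ _
  commutes' c := by
    refine ContinuousLinearMap.ext fun v => Subtype.ext ?_
    exact (map_smul P.1 c (v : DruryArveson d)).trans
      (congrArg (c • ·) (proj_apply_fibre P v))

/-- The fibre `P 𝓜_d|_{P H²_d}` of `𝔐_{d,n}` at `P`, with the norm of operators on `P H²_d`. -/
def MultiplierFibre {d n : ℕ} (P : coinvariantGrassmannian d n) : Type :=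
  (compressionHom P).range

noncomputable instance {d n : ℕ} (P : coinvariantGrassmannian d n) :
    NormedRing (MultiplierFibre P) :=
  inferInstanceAs (NormedRing (compressionHom P).range)

noncomputable instance {d n : ℕ} (P : coinvariantGrassmannian d n) :
    NormedAlgebra ℂ (MultiplierFibre P) :=
  inferInstanceAs (NormedAlgebra ℂ (compressionHom P).range)

/-- The operator on `V^m = ℂ^m ⊗ V` (a Hilbert space) given by an `m × m` matrix of operators on
the Hilbert space `V`. -/
noncomputable def matrixOperator (m : ℕ) (V : Type*) [NormedAddCommGroup V]
    [InnerProductSpace ℂ V] :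
    Matrix (Fin m) (Fin m) (V →L[ℂ] V) →ₐ[ℂ]
      (PiLp 2 (fun _ : Fin m => V) →L[ℂ] PiLp 2 (fun _ : Fin m => V)) where
  toFun A := ((PiLp.continuousLinearEquiv 2 ℂ (fun _ : Fin m => V)).symm :
      (Fin m → V) →L[ℂ] PiLp 2 (fun _ : Fin m => V)) ∘L
    ContinuousLinearMap.pi fun i => ∑ j, A i j ∘L PiLp.proj 2 (fun _ : Fin m => V) j
  map_one' := by
    refine ContinuousLinearMap.ext fun x => PiLp.ext fun i => ?_
    have h : ∀ j, ((1 : Matrix (Fin m) (Fin m) (V →L[ℂ] V)) i j) (x j) =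
        if i = j then x j else 0 := by
      intro j
      by_cases h : i = j <;> simp [Matrix.one_apply, h]
    simp [h]
  map_mul' A B := by
    refine ContinuousLinearMap.ext fun x => PiLp.ext fun i => ?_
    have h : ∀ a, ((A * B) i a) (x a) = ∑ b, A i b (B b a (x a)) := by
      intro a
      simp [Matrix.mul_apply]
    have h' : ∑ a, ((A * B) i a) (x a) = ∑ b, A i b (∑ a, B b a (x a)) := by
      simp only [h, map_sum]
      exact Finset.sum_comm
    simpa using h'
  map_zero' := by
    ext x i
    simp
  map_add' A B := by
    ext x i
    simp [Finset.sum_add_distrib]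
  commutes' c := by
    refine ContinuousLinearMap.ext fun x => PiLp.ext fun i => ?_
    have h : ∀ j, (algebraMap ℂ (Matrix (Fin m) (Fin m) (V →L[ℂ] V)) c i j) (x j) =
        if i = j then c • x j else 0 := by
      intro j
      by_cases h : i = j <;> simp [Matrix.algebraMap_matrix_apply, h]
    simp [h]

/-- The fibre `(I_m ⊗ P) M_m(𝓜_d)|_{ℂ^m ⊗ P H²_d}` of `M_m(𝔐_{d,n})` at `P`, with the norm of
operators on `ℂ^m ⊗ P H²_d = (P H²_d)^m`. -/
def AmplifiedFibre (m : ℕ) {d n : ℕ} (P : coinvariantGrassmannian d n) : Type :=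
  ((matrixOperator m (TautologicalFibre P)).comp (compressionHom P).mapMatrix).range

noncomputable instance (m : ℕ) {d n : ℕ} (P : coinvariantGrassmannian d n) :
    NormedRing (AmplifiedFibre m P) :=
  inferInstanceAs (NormedRing
    ((matrixOperator m (TautologicalFibre P)).comp (compressionHom P).mapMatrix).range)

noncomputable instance (m : ℕ) {d n : ℕ} (P : coinvariantGrassmannian d n) :
    NormedAlgebra ℂ (AmplifiedFibre m P) :=
  inferInstanceAs (NormedAlgebra ℂ
    ((matrixOperator m (TautologicalFibre P)).comp (compressionHom P).mapMatrix).range)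

/-! ## Banach bundles, Banach algebra bundles and Hilbert bundles

For `E : X → Type*`, the total space is `Bundle.TotalSpace F E`, whose parameter `F` is only a
label (it is the model fibre for locally trivial bundles, and `Unit` otherwise). -/

open Bundle in
/-- A Banach bundle: a continuous open surjection from a Hausdorff space (surjectivity is automatic
here, each fibre has a zero) whose fibres are complex Banach spaces, with continuous norm and linear
operations, such that `b_i → 0_x` whenever `‖b_i‖ → 0` and `π(b_i) → x`. -/
structure IsBanachBundle {X : Type*} [TopologicalSpace X] (F : Type*) (E : X → Type*)
    [∀ x, NormedAddCommGroup (E x)] [∀ x, NormedSpace ℂ (E x)]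
    [TopologicalSpace (TotalSpace F E)] : Prop where
  t2Space : T2Space (TotalSpace F E)
  completeSpace : ∀ x, CompleteSpace (E x)
  continuous_proj : Continuous (π F E)
  isOpenMap_proj : IsOpenMap (π F E)
  continuous_norm : Continuous fun b : TotalSpace F E => ‖b.snd‖
  continuous_add : Continuous fun b : TotalSpace (F × F) (E ×ᵇ E) =>
    (⟨b.proj, b.snd.1 + b.snd.2⟩ : TotalSpace F E)
  continuous_smul : ∀ c : ℂ, Continuous fun b : TotalSpace F E =>
    (⟨b.proj, c • b.snd⟩ : TotalSpace F E)
  tendsto_zero : ∀ x : X,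
    Filter.comap (fun b : TotalSpace F E => ‖b.snd‖) (nhds 0) ⊓ Filter.comap (π F E) (nhds x) ≤
      nhds (⟨x, 0⟩ : TotalSpace F E)

open Bundle in
/-- A Banach algebra bundle: a Banach bundle whose fibres are Banach algebras, with continuous
multiplication. -/
structure IsBanachAlgebraBundle {X : Type*} [TopologicalSpace X] (F : Type*) (E : X → Type*)
    [∀ x, NormedRing (E x)] [∀ x, NormedAlgebra ℂ (E x)]
    [TopologicalSpace (TotalSpace F E)] : Prop extends IsBanachBundle F E where
  continuous_mul : Continuous fun b : TotalSpace (F × F) (E ×ᵇ E) =>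
    (⟨b.proj, b.snd.1 * b.snd.2⟩ : TotalSpace F E)

open Bundle in
/-- A locally trivial Hilbert bundle with model fibre the Hilbert space `F`: a Banach bundle with
Hilbert space fibres which near every point of the base admits a trivialization that is a linear
isometry from each fibre onto `F`. -/
structure IsHilbertBundle {X : Type*} [TopologicalSpace X] (F : Type*) [NormedAddCommGroup F]
    [InnerProductSpace ℂ F] (E : X → Type*) [∀ x, NormedAddCommGroup (E x)]
    [∀ x, InnerProductSpace ℂ (E x)] [TopologicalSpace (TotalSpace F E)] : Prop
    extends IsBanachBundle F E where
  exists_trivialization : ∀ x : X, ∃ e : Trivialization F (π F E), x ∈ e.baseSet ∧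
    ∀ y ∈ e.baseSet, ∃ L : E y ≃ₗᵢ[ℂ] F, ∀ v : E y, (e ⟨y, v⟩).2 = L v

open Bundle in
/-- Continuity of a section. -/
def IsContinuousSection {X : Type*} [TopologicalSpace X] (F : Type*) (E : X → Type*)
    [TopologicalSpace (TotalSpace F E)] (s : ∀ x, E x) : Prop :=
  Continuous fun x => (⟨x, s x⟩ : TotalSpace F E)

open Bundle in
/-- The topology on the total space generated by a family `Λ` of sections: a subbase is given by
the tubes `{b | π(b) ∈ U, ‖b - γ(π(b))‖ < ε}`, for `γ ∈ Λ`, `U` open and `ε > 0`. -/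
@[reducible]
def tubeTopology {X : Type*} [TopologicalSpace X] (F : Type*) (E : X → Type*)
    [∀ x, NormedAddCommGroup (E x)] (Λ : Set (∀ x, E x)) : TopologicalSpace (TotalSpace F E) :=
  TopologicalSpace.generateFrom {W | ∃ γ ∈ Λ, ∃ U : Set X, IsOpen U ∧ ∃ ε : ℝ, 0 < ε ∧
    W = {b : TotalSpace F E | b.proj ∈ U ∧ ‖b.snd - γ b.proj‖ < ε}}

/-! ## The bundles `𝓔_{d,n}`, `𝔐_{d,n}` and `M_m(𝔐_{d,n})` -/

/-- The tautological bundle `𝓔_{d,n}`. -/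
abbrev tautologicalBundle (d n : ℕ) : coinvariantGrassmannian d n → Type :=
  fun P => TautologicalFibre P

/-- The total space of `𝓔_{d,n}` is topologized as a subspace of `ℙ_{d,n} × H²_d`. -/
noncomputable instance tautologicalTopology (d n : ℕ) : TopologicalSpace
    (Bundle.TotalSpace (EuclideanSpace ℂ (Fin n)) (tautologicalBundle d n)) :=
  TopologicalSpace.induced (fun b => (b.proj, (b.snd : DruryArveson d))) inferInstance

/-- The bundle `𝔐_{d,n}` of compressed multipliers. -/
abbrev multiplierBundle (d n : ℕ) : coinvariantGrassmannian d n → Type :=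
  fun P => MultiplierFibre P

/-- The section `γ_f : P ↦ P M_f|_{P H²_d}` of `𝔐_{d,n}`. -/
noncomputable def multiplierSection {d : ℕ} (n : ℕ) (f : multiplierAlgebra d) :
    ∀ P, multiplierBundle d n P :=
  fun P => ⟨compressionHom P f, f, rfl⟩

/-- The topology of `𝔐_{d,n}`, generated by the sections `γ_f`. -/
noncomputable instance multiplierTopology (d n : ℕ) :
    TopologicalSpace (Bundle.TotalSpace Unit (multiplierBundle d n)) :=
  tubeTopology Unit (multiplierBundle d n) (Set.range (multiplierSection n))

/-- The bundle `M_m(𝔐_{d,n})`. -/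
abbrev amplifiedBundle (m d n : ℕ) : coinvariantGrassmannian d n → Type :=
  fun P => AmplifiedFibre m P

/-- The section `P ↦ (I_m ⊗ P) M_f|_{ℂ^m ⊗ P H²_d}` of `M_m(𝔐_{d,n})`, for a matrix `f` of
multipliers. -/
noncomputable def amplifiedMultiplierSection {m d : ℕ} (n : ℕ)
    (f : Matrix (Fin m) (Fin m) (multiplierAlgebra d)) : ∀ P, amplifiedBundle m d n P :=
  fun P => ⟨matrixOperator m (TautologicalFibre P) (f.map (compressionHom P)), f, rfl⟩

/-- The topology of `M_m(𝔐_{d,n})`, generated by the sections given by `M_m(𝓜_d)`. -/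
noncomputable instance amplifiedTopology (m d n : ℕ) :
    TopologicalSpace (Bundle.TotalSpace Unit (amplifiedBundle m d n)) :=
  tubeTopology Unit (amplifiedBundle m d n) (Set.range (amplifiedMultiplierSection n))

/-- The section of `M_m(𝔐_{d,n})` given by a matrix of sections of `𝔐_{d,n}`. -/
noncomputable def matrixSection {m d n : ℕ}
    (X : Matrix (Fin m) (Fin m) (∀ P, multiplierBundle d n P)) :
    ∀ P, amplifiedBundle m d n P :=
  fun P => ⟨matrixOperator m (TautologicalFibre P) (Matrix.of fun i j => (X i j P).1), by
    choose f hf using fun i j => (X i j P).2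
    exact ⟨Matrix.of f, congrArg (matrixOperator m (TautologicalFibre P))
      (Matrix.ext fun i j => hf i j)⟩⟩

/-- Bounded sections of `𝔐_{d,n}` and of its amplifications. -/
def IsBoundedSection {X : Type*} {E : X → Type*} [∀ x, NormedAddCommGroup (E x)]
    (s : ∀ x, E x) : Prop :=
  ∃ C : ℝ, ∀ x, ‖s x‖ ≤ C

/-- The supremum norm of a matrix of sections of `𝔐_{d,n}`, seen as a section of
`M_m(𝔐_{d,n})`. -/
noncomputable def supMatrixNorm {m d n : ℕ}
    (X : Matrix (Fin m) (Fin m) (∀ P, multiplierBundle d n P)) : ℝ :=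
  ⨆ P, ‖matrixSection X P‖

/-! ## Operator algebras -/

/-- A unital abstract operator algebra: a unital complex algebra `A` with norms `N m` on all the
spaces `M_m(A)`, complete at the first level, which satisfy Ruan's axioms (so that `A` is an
abstract operator space) and the conditions of Blecher, Ruan and Sinclair: matrix multiplication is
contractive at every level and the unit has norm one. The scalar matrices act with their operator
norm between Euclidean spaces. -/
structure IsAbstractOperatorAlgebra (A : Type*) [Ring A] [Algebra ℂ A]
    (N : ∀ m : ℕ, Matrix (Fin m) (Fin m) A → ℝ) : Prop where
  nonneg : ∀ m X, 0 ≤ N m X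
  eq_zero_iff : ∀ m X, N m X = 0 ↔ X = 0
  add_le : ∀ m X Y, N m (X + Y) ≤ N m X + N m Y
  smul_eq : ∀ m (c : ℂ) X, N m (c • X) = ‖c‖ * N m X
  complete : ∀ u : ℕ → A,
    (∀ ε : ℝ, 0 < ε → ∃ k₀ : ℕ, ∀ k ≥ k₀, ∀ l ≥ k₀, N 1 (Matrix.of fun _ _ => u k - u l) < ε) →
    ∃ a : A, ∀ ε : ℝ, 0 < ε → ∃ k₀ : ℕ, ∀ k ≥ k₀, N 1 (Matrix.of fun _ _ => u k - a) < ε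
  directSum : ∀ (m k : ℕ) (X : Matrix (Fin m) (Fin m) A) (Y : Matrix (Fin k) (Fin k) A),
    N (m + k) (Matrix.reindex finSumFinEquiv finSumFinEquiv (Matrix.fromBlocks X 0 0 Y)) =
      max (N m X) (N k Y)
  scalar_mul_le : ∀ (m k : ℕ) (α : Matrix (Fin k) (Fin m) ℂ) (X : Matrix (Fin m) (Fin m) A)
    (β : Matrix (Fin m) (Fin k) ℂ),
    N k (α.map (algebraMap ℂ A) * X * β.map (algebraMap ℂ A)) ≤
      ‖(Matrix.toEuclideanLin α).toContinuousLinearMap‖ * N m X *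
        ‖(Matrix.toEuclideanLin β).toContinuousLinearMap‖
  mul_le : ∀ m X Y, N m (X * Y) ≤ N m X * N m Y
  one_eq : N 1 1 = 1

/-- `A` with the matrix norms `N` is, completely isometrically and unitally, a norm-closed algebra
of bounded operators on a Hilbert space. -/
def IsRepresentedOperatorAlgebra (A : Type) [Ring A] [Algebra ℂ A]
    (N : ∀ m : ℕ, Matrix (Fin m) (Fin m) A → ℝ) : Prop :=
  ∃ (K : Type) (_ : NormedAddCommGroup K) (_ : InnerProductSpace ℂ K) (_ : CompleteSpace K)
    (ρ : A →ₐ[ℂ] (K →L[ℂ] K)), IsClosed (Set.range ρ) ∧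
      ∀ (m : ℕ) (X : Matrix (Fin m) (Fin m) A), ‖matrixOperator m K (X.map ρ)‖ = N m X

section

open Bundle Filter Topology

/-! ### Bundles generated by a family of sections -/

section FellBundle

variable {X : Type*} {F : Type*} {E : X → Type*}

/-! The multiplier bundles come from Fell's construction. Let `Λ` be a linear family of sections
that fills every fibre and whose norm functions are continuous. In the tube topology, `c → b` means
that the base points converge and that `‖c - γ(π c)‖ → 0` for one, equivalently every, `γ ∈ Λ`
through `b` (`IsGeneratingFamily.tendsto_iff`). The bundle axioms are then triangle inequalities,
and multiplication is continuous as soon as `Λ` is closed under products. Uniqueness holds because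
in any Banach bundle the same two conditions force `c - γ(π c) → 0_x`; adding the continuous section
`γ` back gives `c → b` (`IsBanachBundle.eq_tubeTopology`).

For compressed multipliers the norm at `P` equals that of the matrix `(P T_ij P)` on the fixed space
`(H²_d)^m`, which is norm continuous in `P`. Coinvariance makes compression multiplicative, hence
the closure under products, and the fibres are complete because they are finite-dimensional. A
matrix of operators dominates each of its entries and is dominated by the sum of their norms, so
continuity and boundedness of matrix sections can be tested on entries.

The tautological bundle is trivialized near `P` by projecting an orthonormal basis of `P H²_d` into
the nearby fibres and applying Gram–Schmidt.

Bounded continuous sections act diagonally on the Hilbert sum of all fibres. Matrices of diagonal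
operators have the supremum of the fibre norms as their norm, and the range is closed because
uniform limits of continuous sections are continuous. The operator algebra axioms are then inherited
from bounded operators. Only the norm of the unit needs a nonzero Hilbert space: `ℙ_{d,n}` is
nonempty because kernel functions are joint eigenvectors of the adjoint multipliers and `n` of them
can be chosen linearly independent. -/

theorem tendsto_prodBundle [TopologicalSpace (TotalSpace F E)] {ι : Type*} {l : Filter ι}
    {p : ι → X} {f g : ∀ i, E (p i)} {x : X} {a b : E x}
    (hf : Tendsto (fun i => (⟨p i, f i⟩ : TotalSpace F E)) l (𝓝 ⟨x, a⟩))
    (hg : Tendsto (fun i => (⟨p i, g i⟩ : TotalSpace F E)) l (𝓝 ⟨x, b⟩)) :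
    Tendsto (fun i => (⟨p i, (f i, g i)⟩ : TotalSpace (F × F) (E ×ᵇ E))) l (𝓝 ⟨x, (a, b)⟩) :=
  (FiberBundle.Prod.isInducing_diag F E F E).tendsto_nhds_iff.2 (hf.prodMk_nhds hg)

variable [TopologicalSpace X]

/-- A linear family of sections with continuous norms which exhausts every fibre. -/
structure IsGeneratingFamily [∀ x, NormedAddCommGroup (E x)] [∀ x, NormedSpace ℂ (E x)]
    (Λ : Set (∀ x, E x)) : Prop where
  exists_eq : ∀ x (e : E x), ∃ γ ∈ Λ, γ x = e
  add_mem : ∀ γ ∈ Λ, ∀ δ ∈ Λ, γ + δ ∈ Λ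
  smul_mem : ∀ (c : ℂ), ∀ γ ∈ Λ, c • γ ∈ Λ
  continuous_norm : ∀ γ ∈ Λ, Continuous fun x => ‖γ x‖

/-- The tubes around a section through `b` are neighbourhoods of `b`. This half needs no continuity
of norms and no linearity of `Λ`, so it also serves the uniqueness theorem. -/
theorem tendsto_tubeTopology_of_tendsto [∀ x, NormedAddCommGroup (E x)]
    {Λ : Set (∀ x, E x)} {b : TotalSpace F E} {γ : ∀ x, E x} (hγ : γ ∈ Λ)
    (hb : γ b.proj = b.snd) :
    Tendsto (π F E) (@nhds _ (tubeTopology F E Λ) b) (𝓝 b.proj) ∧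
      Tendsto (fun c : TotalSpace F E => ‖c.snd - γ c.proj‖)
        (@nhds _ (tubeTopology F E Λ) b) (𝓝 0) := by
  let _ := tubeTopology F E Λ
  have hopen : ∀ (U : Set X) (ε : ℝ), IsOpen U → 0 < ε → b.proj ∈ U →
      {c : TotalSpace F E | c.proj ∈ U ∧ ‖c.snd - γ c.proj‖ < ε} ∈ 𝓝 b := fun U ε hU hε hbU =>
    IsOpen.mem_nhds (TopologicalSpace.isOpen_generateFrom_of_mem ⟨γ, hγ, U, hU, ε, hε, rfl⟩)
      ⟨hbU, by simpa [hb] using hε⟩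
  refine ⟨fun U hU => ?_, Metric.tendsto_nhds.2 fun ε hε => ?_⟩
  · obtain ⟨V, hVU, hV, hbV⟩ := mem_nhds_iff.1 hU
    exact mem_map.2 (mem_of_superset (hopen V 1 hV one_pos hbV) fun c hc => hVU hc.1)
  · exact mem_of_superset (hopen Set.univ ε isOpen_univ hε trivial) fun c hc => by
      simpa using hc.2

variable [∀ x, NormedAddCommGroup (E x)] [∀ x, NormedSpace ℂ (E x)]

theorem IsGeneratingFamily.sub_mem {Λ : Set (∀ x, E x)} (h : IsGeneratingFamily Λ)
    {γ δ : ∀ x, E x} (hγ : γ ∈ Λ) (hδ : δ ∈ Λ) : γ - δ ∈ Λ := by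
  rw [sub_eq_add_neg, ← neg_one_smul ℂ δ]
  exact h.add_mem _ hγ _ (h.smul_mem _ _ hδ)

/-- Tubes around a single `γ` through `b` suffice: a tube around another `δ` that contains `b` is
controlled by the triangle inequality and the continuity of `‖γ - δ‖` on the base. -/
theorem IsGeneratingFamily.tendsto_iff {Λ : Set (∀ x, E x)} (h : IsGeneratingFamily Λ)
    {b : TotalSpace F E} {γ : ∀ x, E x} (hγ : γ ∈ Λ) (hb : γ b.proj = b.snd)
    {ι : Type*} {l : Filter ι} {f : ι → TotalSpace F E} :
    Tendsto f l (@nhds _ (tubeTopology F E Λ) b) ↔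
      Tendsto (fun i => (f i).proj) l (𝓝 b.proj) ∧
      Tendsto (fun i => ‖(f i).snd - γ (f i).proj‖) l (𝓝 0) := by
  refine ⟨fun hf => ⟨(tendsto_tubeTopology_of_tendsto hγ hb).1.comp hf,
    (tendsto_tubeTopology_of_tendsto hγ hb).2.comp hf⟩, fun ⟨h1, h2⟩ => ?_⟩
  rw [TopologicalSpace.tendsto_nhds_generateFrom_iff]
  rintro _ ⟨δ, hδ, U, hU, ε, hε, rfl⟩ ⟨hbU, hbε⟩
  have h3 : Tendsto (fun i => ‖(f i).snd - γ (f i).proj‖ + ‖(γ - δ) (f i).proj‖) l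
      (𝓝 (0 + ‖(γ - δ) b.proj‖)) :=
    h2.add (((h.continuous_norm _ (h.sub_mem hγ hδ)).tendsto b.proj).comp h1)
  have h4 : 0 + ‖(γ - δ) b.proj‖ < ε := by simpa [hb] using hbε
  filter_upwards [h1.eventually (hU.mem_nhds hbU), h3.eventually_lt_const h4] with i hi hi'
  refine ⟨hi, lt_of_le_of_lt ?_ hi'⟩
  simpa using norm_add_le ((f i).snd - γ (f i).proj) (γ (f i).proj - δ (f i).proj)

theorem IsGeneratingFamily.continuousAt_section_iff {Λ : Set (∀ x, E x)}
    (h : IsGeneratingFamily Λ) {s γ : ∀ x, E x} (hγ : γ ∈ Λ) {x : X} (hx : γ x = s x) :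
    @ContinuousAt _ _ _ (tubeTopology F E Λ) (fun y => (⟨y, s y⟩ : TotalSpace F E)) x ↔
      Tendsto (fun y => ‖s y - γ y‖) (𝓝 x) (𝓝 0) := by
  let _ := tubeTopology F E Λ
  rw [ContinuousAt, h.tendsto_iff hγ hx]
  exact and_iff_right tendsto_id

theorem IsGeneratingFamily.continuous_section {Λ : Set (∀ x, E x)}
    (h : IsGeneratingFamily Λ) {γ : ∀ x, E x} (hγ : γ ∈ Λ) :
    @IsContinuousSection _ _ F E (tubeTopology F E Λ) γ := by
  let _ := tubeTopology F E Λ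
  refine continuous_iff_continuousAt.2 fun x => ?_
  rw [h.continuousAt_section_iff hγ rfl]
  simp

/-- With `δ ∈ Λ` through `b`, the function differs from the continuous function `‖δ - γ‖` of the
base point by at most `‖c - δ(π c)‖`, which tends to `0` at `b`. -/
theorem IsGeneratingFamily.continuous_norm_sub {Λ : Set (∀ x, E x)}
    (h : IsGeneratingFamily Λ) {γ : ∀ x, E x} (hγ : γ ∈ Λ) :
    @Continuous _ _ (tubeTopology F E Λ) _ fun b : TotalSpace F E => ‖b.snd - γ b.proj‖ := by
  let _ := tubeTopology F E Λ
  refine continuous_iff_continuousAt.2 fun b => ?_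
  obtain ⟨δ, hδ, hb⟩ := h.exists_eq b.proj b.snd
  obtain ⟨h1, h2⟩ := tendsto_tubeTopology_of_tendsto (F := F) hδ hb
  have h3 : Tendsto (fun c : TotalSpace F E => ‖(δ - γ) c.proj‖) (𝓝 b)
      (𝓝 ‖b.snd - γ b.proj‖) := by
    rw [← hb]
    exact ((h.continuous_norm _ (h.sub_mem hδ hγ)).tendsto _).comp h1
  rw [ContinuousAt, tendsto_iff_norm_sub_tendsto_zero]
  have h4 := h2.add (tendsto_iff_norm_sub_tendsto_zero.1 h3)
  rw [add_zero] at h4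
  refine squeeze_zero (fun _ => norm_nonneg _) (fun c => ?_) h4
  refine (norm_sub_le_norm_sub_add_norm_sub _ ‖(δ - γ) c.proj‖ _).trans ?_
  gcongr
  refine (abs_norm_sub_norm_le _ _).trans_eq ?_
  simp

theorem IsGeneratingFamily.zero_mem [Nonempty X] {Λ : Set (∀ x, E x)}
    (h : IsGeneratingFamily Λ) : (0 : ∀ x, E x) ∈ Λ := by
  obtain ⟨γ, hγ, -⟩ := h.exists_eq (Classical.arbitrary X) 0
  simpa using h.smul_mem 0 γ hγ

theorem IsGeneratingFamily.isBanachBundle [T2Space X] [∀ x, CompleteSpace (E x)]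
    {Λ : Set (∀ x, E x)} (h : IsGeneratingFamily Λ) :
    @IsBanachBundle _ _ F E _ _ (tubeTopology F E Λ) := by
  let _ := tubeTopology F E Λ
  have hproj : Continuous (π F E) := continuous_iff_continuousAt.2 fun b => by
    obtain ⟨γ, hγ, hb⟩ := h.exists_eq b.proj b.snd
    exact (tendsto_tubeTopology_of_tendsto hγ hb).1
  have hnorm : Continuous fun b : TotalSpace F E => ‖b.snd‖ := by
    -- The norm is the distance to the zero section, which is known to lie in `Λ` only when the base
    -- has a point.
    rcases isEmpty_or_nonempty X with hX | hX
    · exact continuous_iff_continuousAt.2 fun b => hX.elim b.proj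
    · simpa using h.continuous_norm_sub (F := F) h.zero_mem
  refine ⟨⟨fun b c hbc => ?_⟩, inferInstance, hproj, fun W hW => ?_, hnorm, ?_, fun k => ?_,
    fun x => ?_⟩
  · by_cases hp : b.proj = c.proj
    · obtain ⟨x, b⟩ := b
      obtain ⟨y, c⟩ := c
      obtain rfl : x = y := hp
      -- Two points of one fibre are separated by the distance to a section through the first of
      -- them.
      obtain ⟨γ, hγ, hb⟩ := h.exists_eq x b
      have hne : b ≠ c := fun e => hbc (by rw [e])
      have hpos : 0 < ‖c - b‖ := norm_pos_iff.2 (sub_ne_zero.2 hne.symm)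
      have hcont := h.continuous_norm_sub (F := F) hγ
      refine ⟨_, _, (isOpen_Iio (a := ‖c - b‖ / 2)).preimage hcont,
        (isOpen_Ioi (a := ‖c - b‖ / 2)).preimage hcont, ?_, ?_,
        (Set.Iio_disjoint_Ioi_same).preimage _⟩
      · simpa [hb] using hpos
      · simpa [hb] using half_lt_self hpos
    · obtain ⟨U, V, hU, hV, hbU, hcV, hd⟩ := t2_separation hp
      exact ⟨_, _, hU.preimage hproj, hV.preimage hproj, hbU, hcV, hd.preimage _⟩
  · rw [isOpen_iff_mem_nhds]
    rintro _ ⟨b, hb, rfl⟩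
    -- A continuous section through `b` stays in `W` over a neighbourhood of `π b`, so that
    -- neighbourhood lies in the image of `W`.
    obtain ⟨γ, hγ, hγb⟩ := h.exists_eq b.proj b.snd
    have hc : Continuous fun x => (⟨x, γ x⟩ : TotalSpace F E) := h.continuous_section hγ
    have hbW : (⟨b.proj, γ b.proj⟩ : TotalSpace F E) ∈ W := by rwa [hγb]
    exact mem_of_superset ((hW.preimage hc).mem_nhds hbW) fun x hx => ⟨_, hx, rfl⟩
  · refine continuous_iff_continuousAt.2 fun b => ?_
    obtain ⟨γ, hγ, hγb⟩ := h.exists_eq b.proj b.snd.1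
    obtain ⟨δ, hδ, hδb⟩ := h.exists_eq b.proj b.snd.2
    have hd := (FiberBundle.Prod.isInducing_diag F E F E).continuous.tendsto b
    rw [ContinuousAt, h.tendsto_iff (h.add_mem γ hγ δ hδ) (congrArg₂ (· + ·) hγb hδb)]
    obtain ⟨h1, h2⟩ := (h.tendsto_iff hγ hγb).1 hd.fst_nhds
    obtain ⟨-, h3⟩ := (h.tendsto_iff hδ hδb).1 hd.snd_nhds
    refine ⟨h1, ?_⟩
    have h4 := h2.add h3
    rw [add_zero] at h4
    refine squeeze_zero (fun _ => norm_nonneg _) (fun c => ?_) h4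
    refine le_trans (le_of_eq ?_) (norm_add_le _ _)
    simp only [Pi.add_apply]
    congr 1
    abel
  · refine continuous_iff_continuousAt.2 fun b => ?_
    obtain ⟨γ, hγ, hγb⟩ := h.exists_eq b.proj b.snd
    rw [ContinuousAt, h.tendsto_iff (h.smul_mem k γ hγ) (congrArg (k • ·) hγb)]
    obtain ⟨h1, h2⟩ := (h.tendsto_iff hγ hγb).1 (tendsto_id (x := 𝓝 b))
    refine ⟨h1, ?_⟩
    have h3 := h2.const_mul ‖k‖
    rw [mul_zero] at h3
    refine h3.congr fun c => ?_
    simp only [id, Pi.smul_apply, ← smul_sub, norm_smul]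
  · have : Nonempty X := ⟨x⟩
    refine (h.tendsto_iff (f := id) h.zero_mem rfl).2 ⟨tendsto_comap.mono_left inf_le_right, ?_⟩
    simpa using (tendsto_comap.mono_left inf_le_left : Tendsto (fun b : TotalSpace F E => ‖b.snd‖)
      (comap (fun b : TotalSpace F E => ‖b.snd‖) (𝓝 0) ⊓ comap (π F E) (𝓝 x)) (𝓝 0))

/-- A Banach bundle structure is determined by any family of continuous sections which exhausts
every fibre. -/
theorem IsBanachBundle.eq_tubeTopology [τ : TopologicalSpace (TotalSpace F E)]
    (hτ : IsBanachBundle F E) {Λ : Set (∀ x, E x)} (hc : ∀ γ ∈ Λ, IsContinuousSection F E γ)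
    (hΛ : ∀ x (e : E x), ∃ γ ∈ Λ, γ x = e) : τ = tubeTopology F E Λ := by
  have hadd {ι : Type _} {l : Filter ι} {p : ι → X} {f g : ∀ i, E (p i)} {x : X} {a b : E x}
      (hf : Tendsto (fun i => (⟨p i, f i⟩ : TotalSpace F E)) l (𝓝 ⟨x, a⟩))
      (hg : Tendsto (fun i => (⟨p i, g i⟩ : TotalSpace F E)) l (𝓝 ⟨x, b⟩)) :
      Tendsto (fun i => (⟨p i, f i + g i⟩ : TotalSpace F E)) l (𝓝 ⟨x, a + b⟩) :=
    (hτ.continuous_add.tendsto _).comp (tendsto_prodBundle hf hg)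
  refine le_antisymm (le_generateFrom ?_) (le_of_nhds_le_nhds fun b => ?_)
  · rintro _ ⟨γ, hγ, U, hU, ε, hε, rfl⟩
    refine (hU.preimage hτ.continuous_proj).inter (?_ : IsOpen
      ((fun b : TotalSpace F E => ‖b.snd - γ b.proj‖) ⁻¹' Set.Iio ε))
    refine isOpen_Iio.preimage (continuous_iff_continuousAt.2 fun b => ?_)
    -- Tubes are open for `τ`: subtraction is `τ`-continuous, being addition of the scalar multiple
    -- by `-1`.
    have h1 : Tendsto (fun c : TotalSpace F E => (⟨c.proj, (-1 : ℂ) • γ c.proj⟩ : TotalSpace F E))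
        (𝓝 b) (𝓝 ⟨b.proj, (-1 : ℂ) • γ b.proj⟩) :=
      ((hτ.continuous_smul (-1)).comp ((hc γ hγ).comp hτ.continuous_proj)).tendsto b
    have h2 := (hτ.continuous_norm.tendsto _).comp (hadd (tendsto_id (x := 𝓝 b)) h1)
    simpa [Function.comp_def, ContinuousAt, sub_eq_add_neg] using h2
  · obtain ⟨γ, hγ, hb⟩ := hΛ b.proj b.snd
    obtain ⟨h1, h2⟩ := tendsto_tubeTopology_of_tendsto (F := F) hγ hb
    -- Conversely, tube convergence makes the difference small in norm over convergent base points,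
    -- and `tendsto_zero` turns this into `τ`-convergence to `0_x`.
    have h3 : Tendsto (fun c : TotalSpace F E => (⟨c.proj, c.snd - γ c.proj⟩ : TotalSpace F E))
        (@nhds _ (tubeTopology F E Λ) b) (𝓝 ⟨b.proj, 0⟩) := by
      refine Tendsto.mono_right (tendsto_inf.2 ⟨?_, ?_⟩) (hτ.tendsto_zero b.proj)
      · exact tendsto_comap_iff.2 h2
      · exact tendsto_comap_iff.2 h1
    have h4 : Tendsto (fun c : TotalSpace F E => (⟨c.proj, γ c.proj⟩ : TotalSpace F E))
        (@nhds _ (tubeTopology F E Λ) b) (𝓝 ⟨b.proj, γ b.proj⟩) :=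
      ((hc γ hγ).tendsto b.proj).comp h1
    have h5 := hadd h3 h4
    simp only [sub_add_cancel, zero_add, hb] at h5
    exact tendsto_id'.1 h5

end FellBundle

/-! ### Multiplication in bundles generated by sections -/

section FellAlgebraBundle

variable {X : Type*} [TopologicalSpace X] {F : Type*} {E : X → Type*}
  [∀ x, NormedRing (E x)] [∀ x, NormedAlgebra ℂ (E x)]

/-- Write `b₁ b₂ - γ δ = (b₁ - γ) b₂ + γ (b₂ - δ)`; the factors `‖b₂‖` and `‖γ‖` converge, and the
differences tend to `0`. -/
theorem IsGeneratingFamily.isBanachAlgebraBundle [T2Space X] [∀ x, CompleteSpace (E x)]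
    {Λ : Set (∀ x, E x)} (h : IsGeneratingFamily Λ) (hmul : ∀ γ ∈ Λ, ∀ δ ∈ Λ, γ * δ ∈ Λ) :
    @IsBanachAlgebraBundle _ _ F E _ _ (tubeTopology F E Λ) := by
  let _ := tubeTopology F E Λ
  refine ⟨h.isBanachBundle, continuous_iff_continuousAt.2 fun b => ?_⟩
  obtain ⟨γ, hγ, hγb⟩ := h.exists_eq b.proj b.snd.1
  obtain ⟨δ, hδ, hδb⟩ := h.exists_eq b.proj b.snd.2
  have hd := (FiberBundle.Prod.isInducing_diag F E F E).continuous.tendsto b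
  rw [ContinuousAt, h.tendsto_iff (hmul γ hγ δ hδ) (congrArg₂ (· * ·) hγb hδb)]
  obtain ⟨h1, h2⟩ := (h.tendsto_iff hγ hγb).1 hd.fst_nhds
  obtain ⟨-, h3⟩ := (h.tendsto_iff hδ hδb).1 hd.snd_nhds
  refine ⟨h1, ?_⟩
  have hnorm : Tendsto (fun c : TotalSpace (F × F) (E ×ᵇ E) => ‖c.snd.2‖) (𝓝 b)
      (𝓝 ‖b.snd.2‖) :=
    ((h.isBanachBundle (F := F)).continuous_norm.tendsto _).comp hd.snd_nhds
  have h4 := (h2.mul hnorm).add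
    ((((h.continuous_norm γ hγ).tendsto _).comp h1).mul h3)
  simp only [zero_mul, mul_zero, add_zero] at h4
  refine squeeze_zero (fun _ => norm_nonneg _) (fun c => ?_) h4
  calc ‖c.snd.1 * c.snd.2 - (γ * δ) c.proj‖
      = ‖(c.snd.1 - γ c.proj) * c.snd.2 + γ c.proj * (c.snd.2 - δ c.proj)‖ := by
        simp only [Pi.mul_apply]
        congr 1
        noncomm_ring
    _ ≤ _ := (norm_add_le _ _).trans (add_le_add (norm_mul_le _ _) (norm_mul_le _ _))

end FellAlgebraBundle
-- Continuous sections: algebraic operations and uniform limits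
section FellSections

variable {X : Type*} [TopologicalSpace X] {F : Type*} {E : X → Type*}

theorem IsBanachBundle.isContinuousSection_add [∀ x, NormedAddCommGroup (E x)]
    [∀ x, NormedSpace ℂ (E x)] [TopologicalSpace (TotalSpace F E)] (h : IsBanachBundle F E)
    {s t : ∀ x, E x} (hs : IsContinuousSection F E s) (ht : IsContinuousSection F E t) :
    IsContinuousSection F E (s + t) :=
  continuous_iff_continuousAt.2 fun x =>
    (h.continuous_add.tendsto _).comp (tendsto_prodBundle (hs.tendsto x) (ht.tendsto x))

theorem IsBanachAlgebraBundle.isContinuousSection_mul [∀ x, NormedRing (E x)]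
    [∀ x, NormedAlgebra ℂ (E x)] [TopologicalSpace (TotalSpace F E)]
    (h : IsBanachAlgebraBundle F E)
    {s t : ∀ x, E x} (hs : IsContinuousSection F E s) (ht : IsContinuousSection F E t) :
    IsContinuousSection F E (s * t) :=
  continuous_iff_continuousAt.2 fun x =>
    (h.continuous_mul.tendsto _).comp (tendsto_prodBundle (hs.tendsto x) (ht.tendsto x))

theorem IsGeneratingFamily.isContinuousSection_of_uniform_limit [∀ x, NormedAddCommGroup (E x)]
    [∀ x, NormedSpace ℂ (E x)] {Λ : Set (∀ x, E x)} (h : IsGeneratingFamily Λ) {a : ∀ x, E x}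
    (ha : ∀ ε > 0, ∃ s : ∀ x, E x, @IsContinuousSection _ _ F E (tubeTopology F E Λ) s ∧
      ∀ x, ‖s x - a x‖ ≤ ε) :
    @IsContinuousSection _ _ F E (tubeTopology F E Λ) a := by
  let _ := tubeTopology F E Λ
  refine continuous_iff_continuousAt.2 fun x => ?_
  obtain ⟨γ, hγ, hx⟩ := h.exists_eq x (a x)
  rw [h.continuousAt_section_iff hγ hx, Metric.tendsto_nhds]
  intro ε hε
  -- At `x` the section `s` is within `ε / 3` of `γ x = a x`, so near `x` it is within `ε / 2` of
  -- `γ`; the total `ε / 3 + ε / 2` is below `ε`.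
  obtain ⟨s, hs, hsa⟩ := ha (ε / 3) (by positivity)
  have h1 : Tendsto (fun y => ‖s y - γ y‖) (𝓝 x) (𝓝 ‖s x - γ x‖) :=
    ((h.continuous_norm_sub (F := F) hγ).tendsto _).comp (hs.tendsto x)
  have h2 : ‖s x - γ x‖ < ε / 2 := by
    rw [hx]
    linarith [hsa x]
  filter_upwards [h1.eventually_lt_const h2] with y hy
  have h3 := norm_sub_le_norm_sub_add_norm_sub (a y) (s y) (γ y)
  rw [norm_sub_rev (a y) (s y)] at h3
  rw [dist_zero_right, norm_norm]
  linarith [hsa y]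

end FellSections

/-! ### The tautological bundle -/

section Frame

/-- By induction on the index: the recursion divides only by squared norms of earlier vectors, which
independence keeps nonzero. -/
theorem continuousOn_gramSchmidt {X 𝕜 H ι : Type*} [TopologicalSpace X] [RCLike 𝕜]
    [NormedAddCommGroup H] [InnerProductSpace 𝕜 H] [LinearOrder ι] [LocallyFiniteOrderBot ι]
    [WellFoundedLT ι] {v : X → ι → H} {s : Set X} (hv : ∀ i, ContinuousOn (fun x => v x i) s)
    (hs : ∀ x ∈ s, LinearIndependent 𝕜 (v x)) (i : ι) :
    ContinuousOn (fun x => InnerProductSpace.gramSchmidt 𝕜 (v x) i) s := by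
  induction i using WellFoundedLT.induction with
  | ind i ih =>
    have h : (fun x => InnerProductSpace.gramSchmidt 𝕜 (v x) i) = fun x => v x i -
        ∑ j ∈ Finset.Iio i, (inner 𝕜 (InnerProductSpace.gramSchmidt 𝕜 (v x) j) (v x i) /
          (‖InnerProductSpace.gramSchmidt 𝕜 (v x) j‖ : 𝕜) ^ 2) •
            InnerProductSpace.gramSchmidt 𝕜 (v x) j := by
      ext x
      exact eq_sub_of_add_eq (InnerProductSpace.gramSchmidt_def'' 𝕜 (v x) i).symm
    rw [h]
    refine (hv i).sub (continuousOn_finsetSum _ fun j hj => ?_)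
    have hj' := ih j (Finset.mem_Iio.1 hj)
    refine ContinuousOn.smul (ContinuousOn.div (hj'.inner (hv i)) ?_ fun x hx => ?_) hj'
    · exact (RCLike.continuous_ofReal.comp_continuousOn hj'.norm).pow 2
    · simpa using InnerProductSpace.gramSchmidt_ne_zero (𝕜 := 𝕜) j (hs x hx)

theorem continuousOn_gramSchmidtNormed {X 𝕜 H ι : Type*} [TopologicalSpace X] [RCLike 𝕜]
    [NormedAddCommGroup H] [InnerProductSpace 𝕜 H] [LinearOrder ι] [LocallyFiniteOrderBot ι]
    [WellFoundedLT ι] {v : X → ι → H} {s : Set X} (hv : ∀ i, ContinuousOn (fun x => v x i) s)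
    (hs : ∀ x ∈ s, LinearIndependent 𝕜 (v x)) (i : ι) :
    ContinuousOn (fun x => InnerProductSpace.gramSchmidtNormed 𝕜 (v x) i) s := by
  have h := continuousOn_gramSchmidt hv hs i
  refine ContinuousOn.smul (ContinuousOn.inv₀ ?_ fun x hx => ?_) h
  · exact RCLike.continuous_ofReal.comp_continuousOn h.norm
  · simpa using InnerProductSpace.gramSchmidt_ne_zero (𝕜 := 𝕜) i (hs x hx)

end Frame

/-! ### Unitary local trivializations of the tautological bundle -/

section Tautological

variable {d n : ℕ}

instance (P : coinvariantGrassmannian d n) : FiniteDimensional ℂ (TautologicalFibre P) :=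
  Module.finite_of_rank_eq_nat P.2.2.2.2

theorem finrank_tautologicalFibre (P : coinvariantGrassmannian d n) :
    Module.finrank ℂ (TautologicalFibre P) = n :=
  Module.finrank_eq_of_rank_eq P.2.2.2.2

/-- The vector `P h` as an element of the fibre `P H²_d`. -/
noncomputable def toTautologicalFibre (P : coinvariantGrassmannian d n) :
    DruryArveson d →L[ℂ] TautologicalFibre P :=
  P.1.codRestrict (LinearMap.range (P.1 : DruryArveson d →ₗ[ℂ] DruryArveson d))
    fun h => ⟨h, rfl⟩

theorem toTautologicalFibre_coe (P : coinvariantGrassmannian d n) (v : TautologicalFibre P) :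
    toTautologicalFibre P v = v :=
  Subtype.ext (proj_apply_fibre P v)

theorem isInducing_tautological : IsInducing (fun b : TotalSpace (EuclideanSpace ℂ (Fin n))
    (tautologicalBundle d n) => (b.proj, (b.snd : DruryArveson d))) := ⟨rfl⟩

theorem tautologicalBundle_isBanachBundle :
    IsBanachBundle (EuclideanSpace ℂ (Fin n)) (tautologicalBundle d n) := by
  have hi := isInducing_tautological (d := d) (n := n)
  have hp : Continuous (π (EuclideanSpace ℂ (Fin n)) (tautologicalBundle d n)) :=
    continuous_fst.comp hi.continuous
  have hs : Continuous fun b : TotalSpace (EuclideanSpace ℂ (Fin n)) (tautologicalBundle d n) =>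
      (b.snd : DruryArveson d) := continuous_snd.comp hi.continuous
  refine ⟨?_, fun P => FiniteDimensional.complete ℂ _, hp, fun W hW => ?_, hs.norm, ?_,
    fun c => ?_, fun P => ?_⟩
  · refine T2Space.of_injective_continuous (f := fun b : TotalSpace (EuclideanSpace ℂ (Fin n))
      (tautologicalBundle d n) => (b.proj, (b.snd : DruryArveson d))) ?_ hi.continuous
    rintro ⟨P, v⟩ ⟨Q, w⟩ h
    obtain ⟨h1, h2⟩ := Prod.ext_iff.1 h
    obtain rfl : P = Q := h1
    exact congrArg (TotalSpace.mk P) (Subtype.ext h2)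
  · rw [isOpen_iff_mem_nhds]
    rintro _ ⟨⟨P, v⟩, hb, rfl⟩
    -- Since `P v = v`, the section `Q ↦ Q v` passes through `v`; its continuity gives openness of
    -- the projection.
    have hc : Continuous fun Q : coinvariantGrassmannian d n =>
        (⟨Q, toTautologicalFibre Q v⟩ : TotalSpace (EuclideanSpace ℂ (Fin n))
          (tautologicalBundle d n)) := by
      refine hi.continuous_iff.2 (continuous_id.prodMk ?_)
      exact continuous_subtype_val.clm_apply continuous_const
    refine mem_of_superset ((hW.preimage hc).mem_nhds ?_) fun Q hQ => ⟨_, hQ, rfl⟩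
    change (⟨P, toTautologicalFibre P v⟩ : TotalSpace _ _) ∈ W
    rwa [toTautologicalFibre_coe]
  · have hd := (FiberBundle.Prod.isInducing_diag (EuclideanSpace ℂ (Fin n))
      (tautologicalBundle d n) (EuclideanSpace ℂ (Fin n)) (tautologicalBundle d n)).continuous
    exact hi.continuous_iff.2 ((hp.comp hd.fst).prodMk ((hs.comp hd.fst).add (hs.comp hd.snd)))
  · exact hi.continuous_iff.2 (hp.prodMk (hs.const_smul c))
  · rw [hi.nhds_eq_comap, ← map_le_iff_le_comap, nhds_prod_eq]
    have h0 : Tendsto (fun b : TotalSpace (EuclideanSpace ℂ (Fin n)) (tautologicalBundle d n) =>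
        ‖(b.snd : DruryArveson d)‖) (comap (fun b : TotalSpace (EuclideanSpace ℂ (Fin n))
          (tautologicalBundle d n) => ‖b.snd‖) (𝓝 0) ⊓ comap (π _ _) (𝓝 P)) (𝓝 0) :=
      tendsto_comap.mono_left inf_le_left
    exact (tendsto_comap.mono_left inf_le_right).prodMk
      (tendsto_zero_iff_norm_tendsto_zero.2 h0)

/-- The orthonormal frame of the fibre at `Q` got by applying the Gram–Schmidt process to the
projections of the vectors `b i`. -/
noncomputable def projectedFrame (b : Fin n → DruryArveson d) (Q : coinvariantGrassmannian d n) :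
    Fin n → DruryArveson d :=
  InnerProductSpace.gramSchmidtNormed ℂ fun i => Q.1 (b i)

/-- The projections for which the frame is a basis of the fibre. -/
def frameDomain (b : Fin n → DruryArveson d) : Set (coinvariantGrassmannian d n) :=
  {Q | LinearIndependent ℂ fun i => Q.1 (b i)}

theorem continuous_proj_frame (b : Fin n → DruryArveson d) (i : Fin n) :
    Continuous fun Q : coinvariantGrassmannian d n => Q.1 (b i) :=
  continuous_subtype_val.clm_apply continuous_const

theorem isOpen_frameDomain (b : Fin n → DruryArveson d) : IsOpen (frameDomain b) :=
  isOpen_setOfPred_linearIndependent.preimage (continuous_pi fun i => continuous_proj_frame b i)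

theorem continuousOn_projectedFrame (b : Fin n → DruryArveson d) (i : Fin n) :
    ContinuousOn (fun Q => projectedFrame b Q i) (frameDomain b) :=
  continuousOn_gramSchmidtNormed (fun i => (continuous_proj_frame b i).continuousOn)
    (fun _ hQ => hQ) i

theorem projectedFrame_mem (b : Fin n → DruryArveson d) (Q : coinvariantGrassmannian d n)
    (i : Fin n) : projectedFrame b Q i ∈
      LinearMap.range (Q.1 : DruryArveson d →ₗ[ℂ] DruryArveson d) := by
  have h1 : projectedFrame b Q i ∈ Submodule.span ℂ (Set.range (projectedFrame b Q)) :=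
    Submodule.subset_span ⟨i, rfl⟩
  rw [projectedFrame, InnerProductSpace.span_gramSchmidtNormed_range,
    InnerProductSpace.span_gramSchmidt] at h1
  refine Submodule.span_le.2 ?_ h1
  rintro _ ⟨j, rfl⟩
  exact ⟨b j, rfl⟩

theorem orthonormal_projectedFrame (b : Fin n → DruryArveson d) {Q : coinvariantGrassmannian d n}
    (hQ : Q ∈ frameDomain b) : Orthonormal ℂ fun i =>
      (⟨projectedFrame b Q i, projectedFrame_mem b Q i⟩ : TautologicalFibre Q) :=
  Orthonormal.codRestrict (InnerProductSpace.gramSchmidtNormed_orthonormal hQ) _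
    (projectedFrame_mem b Q)

/-- The frame as an orthonormal basis of the fibre. -/
noncomputable def frameBasis (b : Fin n → DruryArveson d) {Q : coinvariantGrassmannian d n}
    (hQ : Q ∈ frameDomain b) : OrthonormalBasis (Fin n) ℂ (TautologicalFibre Q) :=
  OrthonormalBasis.mk (orthonormal_projectedFrame b hQ)
    ((orthonormal_projectedFrame b hQ).linearIndependent.span_eq_top_of_card_eq_finrank'
      (by rw [finrank_tautologicalFibre, Fintype.card_fin])).ge

theorem coe_frameBasis (b : Fin n → DruryArveson d) {Q : coinvariantGrassmannian d n}
    (hQ : Q ∈ frameDomain b) (i : Fin n) :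
    (frameBasis b hQ i : DruryArveson d) = projectedFrame b Q i :=
  congrArg Subtype.val (congrFun (OrthonormalBasis.coe_mk (orthonormal_projectedFrame b hQ) _) i)

theorem frameBasis_repr (b : Fin n → DruryArveson d) {Q : coinvariantGrassmannian d n}
    (hQ : Q ∈ frameDomain b) (v : TautologicalFibre Q) :
    (frameBasis b hQ).repr v =
      WithLp.toLp 2 fun i => inner ℂ (projectedFrame b Q i) (v : DruryArveson d) := by
  ext i
  rw [OrthonormalBasis.repr_apply_apply, Submodule.coe_inner, coe_frameBasis]

/-- The projection does not change the sum. It makes the formula land in the fibre at every `Q`, as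
needed for the inverse of the trivialization, and makes continuity in `(Q, c)` visible in `H²_d`. -/
theorem frameBasis_repr_symm (b : Fin n → DruryArveson d) {Q : coinvariantGrassmannian d n}
    (hQ : Q ∈ frameDomain b) (c : EuclideanSpace ℂ (Fin n)) :
    (frameBasis b hQ).repr.symm c =
      toTautologicalFibre Q (∑ i, c i • projectedFrame b Q i) := by
  rw [← (frameBasis b hQ).sum_repr_symm, ← toTautologicalFibre_coe Q (∑ i, _)]
  simp [coe_frameBasis]

/-- The unitary trivialization of `𝓔_{d,n}` given by an orthonormal frame. -/
noncomputable def frameTrivialization (b : Fin n → DruryArveson d) :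
    Trivialization (EuclideanSpace ℂ (Fin n))
      (π (EuclideanSpace ℂ (Fin n)) (tautologicalBundle d n)) where
  toFun a := (a.proj, WithLp.toLp 2 fun i => inner ℂ (projectedFrame b a.proj i)
    (a.snd : DruryArveson d))
  invFun p := ⟨p.1, toTautologicalFibre p.1 (∑ i, p.2 i • projectedFrame b p.1 i)⟩
  source := π _ _ ⁻¹' frameDomain b
  target := frameDomain b ×ˢ Set.univ
  baseSet := frameDomain b
  map_source' a ha := ⟨ha, trivial⟩
  map_target' p hp := hp.1
  left_inv' := by
    rintro ⟨Q, v⟩ (hQ : Q ∈ frameDomain b)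
    refine congrArg (TotalSpace.mk Q) ?_
    exact (frameBasis_repr_symm b hQ _).symm.trans
      ((congrArg _ (frameBasis_repr b hQ v).symm).trans
        ((frameBasis b hQ).repr.symm_apply_apply v))
  right_inv' := by
    rintro ⟨Q, c⟩ ⟨hQ, -⟩
    have hQ' : Q ∈ frameDomain b := hQ
    refine Prod.ext rfl ((frameBasis_repr b hQ' _).symm.trans ?_)
    exact (congrArg _ (frameBasis_repr_symm b hQ' c).symm).trans
      ((frameBasis b hQ').repr.apply_symm_apply c)
  open_source := (isOpen_frameDomain b).preimage tautologicalBundle_isBanachBundle.continuous_proj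
  open_target := (isOpen_frameDomain b).prod isOpen_univ
  continuousOn_toFun := by
    have hi := isInducing_tautological (d := d) (n := n)
    refine tautologicalBundle_isBanachBundle.continuous_proj.continuousOn.prodMk
      ((PiLp.continuous_toLp 2 _).comp_continuousOn (continuousOn_pi.2 fun i => ?_))
    exact ((continuousOn_projectedFrame b i).comp
      tautologicalBundle_isBanachBundle.continuous_proj.continuousOn fun a ha => ha).inner
        (continuous_snd.comp hi.continuous).continuousOn
  continuousOn_invFun := by
    refine isInducing_tautological.continuousOn_iff.2 (continuousOn_fst.prodMk ?_)
    refine ContinuousOn.clm_apply (continuous_subtype_val.comp_continuousOn continuousOn_fst)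
      (continuousOn_finsetSum _ fun i _ => ContinuousOn.fun_smul ?_ ?_)
    · exact ((PiLp.continuous_apply 2 _ i).comp continuous_snd).continuousOn
    · exact (continuousOn_projectedFrame b i).comp continuousOn_fst fun p hp => hp.1
  open_baseSet := isOpen_frameDomain b
  source_eq := rfl
  target_eq := rfl
  proj_toFun _ _ := rfl

theorem tautologicalBundle_isHilbertBundle :
    IsHilbertBundle (EuclideanSpace ℂ (Fin n)) (tautologicalBundle d n) := by
  refine ⟨tautologicalBundle_isBanachBundle, fun P => ?_⟩
  let b := (stdOrthonormalBasis ℂ (TautologicalFibre P)).reindex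
    (finCongr (finrank_tautologicalFibre P))
  refine ⟨frameTrivialization fun i => (b i : DruryArveson d), ?_, fun Q hQ =>
    ⟨(frameBasis _ hQ).repr, fun v => (frameBasis_repr _ hQ v).symm⟩⟩
  -- At `P` itself the projected vectors are the basis vectors, so `P` lies in the frame domain.
  change LinearIndependent ℂ fun i => P.1 (b i)
  simp only [proj_apply_fibre]
  exact b.orthonormal.linearIndependent.map' (Submodule.subtype _) (Submodule.ker_subtype _)

end Tautological

/-! ### Norms of matrices of operators -/

section MatrixOperator

theorem PiLp.norm_le_norm_of_forall {ι V W : Type*} [Fintype ι] [NormedAddCommGroup V]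
    [NormedAddCommGroup W] {x : PiLp 2 fun _ : ι => V} {y : PiLp 2 fun _ : ι => W}
    (h : ∀ i, ‖x i‖ ≤ ‖y i‖) : ‖x‖ ≤ ‖y‖ := by
  rw [PiLp.norm_eq_of_L2, PiLp.norm_eq_of_L2]
  gcongr with i
  exact h i

variable {m k : ℕ} {V W : Type*} [NormedAddCommGroup V] [InnerProductSpace ℂ V]
  [NormedAddCommGroup W] [InnerProductSpace ℂ W]

/-- A shortcut for instance search. -/
noncomputable instance amplifiedOperatorSeminormedAddCommGroup :
    SeminormedAddCommGroup
      ((PiLp 2 fun _ : Fin m => V) →L[ℂ] PiLp 2 fun _ : Fin m => V) :=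
  ContinuousLinearMap.toSeminormedAddCommGroup

/-- A shortcut for instance search. -/
noncomputable instance amplifiedOperatorSeminormedAddGroup :
    SeminormedAddGroup
      ((PiLp 2 fun _ : Fin m => V) →L[ℂ] PiLp 2 fun _ : Fin m => V) :=
  SeminormedAddCommGroup.toSeminormedAddGroup

theorem matrixOperator_apply (A : Matrix (Fin m) (Fin m) (V →L[ℂ] V))
    (x : PiLp 2 fun _ : Fin m => V) (i : Fin m) :
    matrixOperator m V A x i = ∑ j, A i j (x j) := by
  simp [matrixOperator]

theorem norm_entry_le_norm_matrixOperator (A : Matrix (Fin m) (Fin m) (V →L[ℂ] V))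
    (i j : Fin m) : ‖A i j‖ ≤ ‖matrixOperator m V A‖ := by
  refine ContinuousLinearMap.opNorm_le_bound _ (norm_nonneg _) fun v => ?_
  have h : matrixOperator m V A (PiLp.single 2 j v) i = A i j v := by
    rw [matrixOperator_apply, Finset.sum_eq_single j]
    · rw [PiLp.single_eq_same]
    · intro b _ hb
      rw [PiLp.single_eq_of_ne 2 hb, map_zero]
    · simp
  rw [← h]
  refine (PiLp.norm_apply_le _ i).trans ((ContinuousLinearMap.le_opNorm _ _).trans_eq ?_)
  rw [PiLp.norm_single]

/-- Together with `norm_entry_le_norm_matrixOperator` this compares the matrix norm with the entry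
norms by constants that do not depend on `V`, hence uniformly over all fibres. -/
theorem norm_matrixOperator_le_sum (A : Matrix (Fin m) (Fin m) (V →L[ℂ] V)) :
    ‖matrixOperator m V A‖ ≤ ∑ i, ∑ j, ‖A i j‖ := by
  refine ContinuousLinearMap.opNorm_le_bound _ (by positivity) fun x => ?_
  have h : matrixOperator m V A x = ∑ i, PiLp.single 2 i (∑ j, A i j (x j)) := by
    refine PiLp.ext fun i => ?_
    rw [WithLp.ofLp_sum, Finset.sum_apply, Finset.sum_eq_single i]
    · rw [PiLp.single_eq_same, matrixOperator_apply]
    · intro b _ hb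
      rw [PiLp.single_eq_of_ne' 2 hb]
    · simp
  rw [h, Finset.sum_mul]
  refine (norm_sum_le _ _).trans (Finset.sum_le_sum fun i _ => ?_)
  rw [PiLp.norm_single, Finset.sum_mul]
  refine (norm_sum_le _ _).trans (Finset.sum_le_sum fun j _ => ?_)
  exact ((A i j).le_opNorm _).trans (by gcongr; exact PiLp.norm_apply_le x j)

theorem matrixOperator_injective : Function.Injective (matrixOperator m V) := by
  refine (injective_iff_map_eq_zero _).2 fun A hA => ?_
  ext1 i j
  have h := norm_entry_le_norm_matrixOperator A i j
  rw [hA, norm_zero] at h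
  exact norm_le_zero_iff.1 h

theorem continuous_matrixOperator :
    Continuous fun A : Fin m → Fin m → (V →L[ℂ] V) => matrixOperator m V (Matrix.of A) := by
  refine continuous_iff_continuousAt.2 fun A => ?_
  rw [ContinuousAt, tendsto_iff_norm_sub_tendsto_zero]
  have h : Continuous fun B : Fin m → Fin m → (V →L[ℂ] V) => ∑ i, ∑ j, ‖B i j - A i j‖ := by
    fun_prop
  have h' := h.tendsto A
  simp only [sub_self, norm_zero, Finset.sum_const_zero] at h'
  refine squeeze_zero (fun _ => norm_nonneg _) (fun B => ?_) h'
  rw [← map_sub]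
  exact norm_matrixOperator_le_sum _

theorem norm_matrixOperator_one (a : V →L[ℂ] V) :
    ‖matrixOperator 1 V (Matrix.of fun _ _ => a)‖ = ‖a‖ :=
  le_antisymm (by simpa using norm_matrixOperator_le_sum (Matrix.of fun _ _ : Fin 1 => a))
    (norm_entry_le_norm_matrixOperator (Matrix.of fun _ _ : Fin 1 => a) 0 0)

/-- Conjugating the entries by an isometric inclusion and a contractive retraction does not change
the norm of a matrix of operators. -/
theorem norm_matrixOperator_conj (J : V →L[ℂ] W) (Q : W →L[ℂ] V) (hJ : ∀ v, ‖J v‖ = ‖v‖)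
    (hQ : ∀ w, ‖Q w‖ ≤ ‖w‖) (hQJ : ∀ v, Q (J v) = v)
    (A : Matrix (Fin m) (Fin m) (V →L[ℂ] V)) :
    ‖matrixOperator m W (Matrix.of fun i j => J ∘L A i j ∘L Q)‖ = ‖matrixOperator m V A‖ := by
  refine le_antisymm ?_ ?_
  -- For `≤`, a vector of `W^m` is pushed to `V^m` by the contraction `Q`; for `≥`, a vector of
  -- `V^m` is moved to `W^m` by the isometry `J`.
  · refine ContinuousLinearMap.opNorm_le_bound _ (norm_nonneg _) fun x => ?_
    calc _ ≤ ‖matrixOperator m V A (WithLp.toLp 2 fun j => Q (x j))‖ :=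
          PiLp.norm_le_norm_of_forall fun i => by
            simp only [matrixOperator_apply, Matrix.of_apply, ContinuousLinearMap.comp_apply,
              ← map_sum, hJ]
            rfl
      _ ≤ _ := (ContinuousLinearMap.le_opNorm _ _).trans
          (by gcongr; exact PiLp.norm_le_norm_of_forall fun i => hQ _)
  · refine ContinuousLinearMap.opNorm_le_bound _ (norm_nonneg _) fun x => ?_
    calc _ ≤ ‖matrixOperator m W (Matrix.of fun i j => J ∘L A i j ∘L Q)
          (WithLp.toLp 2 fun j => J (x j))‖ :=
          PiLp.norm_le_norm_of_forall fun i => by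
            simp [matrixOperator_apply, hQJ, ← map_sum, hJ]
      _ ≤ _ := (ContinuousLinearMap.le_opNorm _ _).trans
          (by gcongr; exact PiLp.norm_le_norm_of_forall fun i => (hJ _).le)

omit [InnerProductSpace ℂ V] in
theorem norm_sq_toLp_append (x : Fin (m + k) → V) :
    ‖(WithLp.toLp 2 x : PiLp 2 fun _ : Fin (m + k) => V)‖ ^ 2 =
      ‖(WithLp.toLp 2 fun i => x (Fin.castAdd k i) : PiLp 2 fun _ : Fin m => V)‖ ^ 2 +
        ‖(WithLp.toLp 2 fun i => x (Fin.natAdd m i) : PiLp 2 fun _ : Fin k => V)‖ ^ 2 := by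
  simp only [PiLp.norm_sq_eq_of_L2, Fin.sum_univ_add]

/-- The squared norm of `T x` splits into those of `A` and `B` on the two halves of `x`. Tuples
padded by zeros show that both norms are attained as lower bounds. -/
theorem norm_matrixOperator_directSum (A : Matrix (Fin m) (Fin m) (V →L[ℂ] V))
    (B : Matrix (Fin k) (Fin k) (V →L[ℂ] V)) :
    ‖matrixOperator (m + k) V
      (Matrix.reindex finSumFinEquiv finSumFinEquiv (Matrix.fromBlocks A 0 0 B))‖ =
      max ‖matrixOperator m V A‖ ‖matrixOperator k V B‖ := by
  set T := matrixOperator (m + k) V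
    (Matrix.reindex finSumFinEquiv finSumFinEquiv (Matrix.fromBlocks A 0 0 B)) with hT
  have hl : ∀ (x : PiLp 2 fun _ : Fin (m + k) => V) (i : Fin m), T x (Fin.castAdd k i) =
      matrixOperator m V A (WithLp.toLp 2 fun i => x (Fin.castAdd k i)) i := fun x i => by
    simp [hT, matrixOperator_apply, Fin.sum_univ_add]
  have hr : ∀ (x : PiLp 2 fun _ : Fin (m + k) => V) (i : Fin k), T x (Fin.natAdd m i) =
      matrixOperator k V B (WithLp.toLp 2 fun i => x (Fin.natAdd m i)) i := fun x i => by
    simp [hT, matrixOperator_apply, Fin.sum_univ_add]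
  have key : ∀ x : PiLp 2 fun _ : Fin (m + k) => V, ‖T x‖ ^ 2 =
      ‖matrixOperator m V A (WithLp.toLp 2 fun i => x (Fin.castAdd k i))‖ ^ 2 +
      ‖matrixOperator k V B (WithLp.toLp 2 fun i => x (Fin.natAdd m i))‖ ^ 2 := fun x => by
    refine (norm_sq_toLp_append (T x).ofLp).trans ?_
    simp only [hl, hr]
  refine le_antisymm ?_ (max_le ?_ ?_)
  · refine ContinuousLinearMap.opNorm_le_bound _ (by positivity) fun x => ?_
    refine abs_le_of_sq_le_sq' ?_ (by positivity) |>.2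
    rw [key, mul_pow, (norm_sq_toLp_append x.ofLp : ‖x‖ ^ 2 = _), mul_add, ← mul_pow, ← mul_pow]
    gcongr
    · exact (ContinuousLinearMap.le_opNorm _ _).trans (by gcongr; exact le_max_left _ _)
    · exact (ContinuousLinearMap.le_opNorm _ _).trans (by gcongr; exact le_max_right _ _)
  · refine ContinuousLinearMap.opNorm_le_bound _ (norm_nonneg _) fun v => ?_
    let x : PiLp 2 fun _ : Fin (m + k) => V := WithLp.toLp 2 (Fin.append v.ofLp 0)
    have hx : ‖x‖ = ‖v‖ := by
      rw [← sq_eq_sq₀ (norm_nonneg _) (norm_nonneg _), norm_sq_toLp_append]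
      simp [PiLp.norm_sq_eq_of_L2]
    rw [← hx]
    refine le_trans ?_ (T.le_opNorm x)
    refine abs_le_of_sq_le_sq' ?_ (by positivity) |>.2
    rw [key]
    simp [x]
  · refine ContinuousLinearMap.opNorm_le_bound _ (norm_nonneg _) fun v => ?_
    let x : PiLp 2 fun _ : Fin (m + k) => V := WithLp.toLp 2 (Fin.append 0 v.ofLp)
    have hx : ‖x‖ = ‖v‖ := by
      rw [← sq_eq_sq₀ (norm_nonneg _) (norm_nonneg _), norm_sq_toLp_append]
      simp [PiLp.norm_sq_eq_of_L2]
    rw [← hx]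
    refine le_trans ?_ (T.le_opNorm x)
    refine abs_le_of_sq_le_sq' ?_ (by positivity) |>.2
    rw [key]
    simp [x]

/-- A scalar matrix acts on tuples of vectors with at most its Euclidean operator norm. -/
theorem norm_scalarMatrix_apply_le (α : Matrix (Fin k) (Fin m) ℂ)
    (x : PiLp 2 fun _ : Fin m => V) :
    ‖(WithLp.toLp 2 fun i => ∑ j, α i j • x j : PiLp 2 fun _ : Fin k => V)‖ ≤
      ‖(Matrix.toEuclideanLin α).toContinuousLinearMap‖ * ‖x‖ := by
  -- In an orthonormal basis of the span of the `x j`, the matrix acts on each coordinate separately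
  -- as on `ℂ^m`, where the bound is the definition of the Euclidean operator norm.
  let U := Submodule.span ℂ (Set.range x.ofLp)
  have : FiniteDimensional ℂ U := FiniteDimensional.span_of_finite ℂ (Set.finite_range _)
  let e := stdOrthonormalBasis ℂ U
  have hsum : ∀ {l : ℕ} (y : PiLp 2 fun _ : Fin l => V), (∀ i, y i ∈ U) → ‖y‖ ^ 2 =
      ∑ b, ‖(WithLp.toLp 2 fun i => inner ℂ (e b : V) (y i) : EuclideanSpace ℂ (Fin l))‖ ^ 2 := by
    intro l y hy
    simp only [PiLp.norm_sq_eq_of_L2]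
    rw [Finset.sum_comm]
    refine Finset.sum_congr rfl fun i _ => ?_
    exact (e.sum_sq_norm_inner_right ⟨y i, hy i⟩).symm
  have hx : ∀ j, x j ∈ U := fun j => Submodule.subset_span ⟨j, rfl⟩
  refine abs_le_of_sq_le_sq' ?_ (by positivity) |>.2
  rw [hsum _ fun i => (Submodule.sum_mem _ fun j _ => Submodule.smul_mem _ _ (hx j) :
    ∑ j, α i j • x j ∈ U), mul_pow, hsum x hx, Finset.mul_sum]
  refine Finset.sum_le_sum fun b _ => ?_
  rw [← mul_pow]
  gcongr
  refine le_trans (le_of_eq ?_) (ContinuousLinearMap.le_opNorm _ _)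
  congr 1
  ext i
  simp [Matrix.toLpLin_apply, Matrix.mulVec, dotProduct]

/-- The operator factors as the scalar action of `β`, then `A`, then the scalar action of `α`. -/
theorem norm_matrixOperator_scalar_mul_le (α : Matrix (Fin k) (Fin m) ℂ)
    (A : Matrix (Fin m) (Fin m) (V →L[ℂ] V)) (β : Matrix (Fin m) (Fin k) ℂ) :
    ‖matrixOperator k V (α.map (algebraMap ℂ (V →L[ℂ] V)) * A *
        β.map (algebraMap ℂ (V →L[ℂ] V)))‖ ≤
      ‖(Matrix.toEuclideanLin α).toContinuousLinearMap‖ * ‖matrixOperator m V A‖ *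
        ‖(Matrix.toEuclideanLin β).toContinuousLinearMap‖ := by
  refine ContinuousLinearMap.opNorm_le_bound _ (by positivity) fun x => ?_
  let y : PiLp 2 fun _ : Fin m => V := WithLp.toLp 2 fun i => ∑ j, β i j • x j
  have h : matrixOperator k V (α.map (algebraMap ℂ (V →L[ℂ] V)) * A *
      β.map (algebraMap ℂ (V →L[ℂ] V))) x =
      WithLp.toLp 2 fun i => ∑ j, α i j • matrixOperator m V A y j := by
    ext i
    simp only [matrixOperator_apply, Matrix.mul_apply, Matrix.map_apply,
      sum_apply, mul_apply_eq_comp,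
      ContinuousLinearMap.algebraMap_apply, y, map_sum, map_smul, Finset.smul_sum]
    rw [Finset.sum_comm]
    simp only [Finset.sum_comm (s := (Finset.univ : Finset (Fin k)))]
    rw [Finset.sum_comm]
    refine Finset.sum_congr rfl fun a _ => Finset.sum_congr rfl fun b _ =>
      Finset.sum_congr rfl fun c _ => ?_
    rw [smul_comm]
  rw [h]
  refine (norm_scalarMatrix_apply_le α _).trans ?_
  rw [mul_assoc, mul_assoc]
  gcongr
  exact (ContinuousLinearMap.le_opNorm _ _).trans
    (by gcongr; exact norm_scalarMatrix_apply_le β x)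

end MatrixOperator

/-! ### Diagonal operators on Hilbert sums -/

section Diagonal

variable {ι : Type*} {V : ι → Type*} [∀ p, NormedAddCommGroup (V p)]
  [∀ p, InnerProductSpace ℂ (V p)] {m : ℕ}

omit [∀ p, InnerProductSpace ℂ (V p)] in
-- This is the isometry between `(⨁ V p)^m` and `⨁ (V p)^m`, under which a matrix of diagonal
-- operators is block diagonal with blocks `T p`.
theorem hasSum_norm_sq_piLp_lp (y : PiLp 2 fun _ : Fin m => lp V 2) :
    HasSum (fun p => ‖(WithLp.toLp 2 fun i => y i p : PiLp 2 fun _ : Fin m => V p)‖ ^ 2)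
      (‖y‖ ^ 2) := by
  simp only [PiLp.norm_sq_eq_of_L2]
  refine hasSum_sum fun i _ => ?_
  simpa using lp.hasSum_norm (p := 2) (by norm_num) (y i)

theorem matrixOperator_diagonal_apply {A : Matrix (Fin m) (Fin m) (lp V 2 →L[ℂ] lp V 2)}
    {T : ∀ p, Matrix (Fin m) (Fin m) (V p →L[ℂ] V p)}
    (hA : ∀ i j x p, (A i j x) p = T p i j (x p)) (x : PiLp 2 fun _ : Fin m => lp V 2) (p : ι)
    (i : Fin m) : (matrixOperator m (lp V 2) A x i) p =
      matrixOperator m (V p) (T p) (WithLp.toLp 2 fun j => x j p) i := by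
  rw [matrixOperator_apply, matrixOperator_apply, lp.coeFn_sum]
  exact (Finset.sum_apply p _ _).trans (Finset.sum_congr rfl fun j _ => hA i j _ p)

theorem norm_matrixOperator_le_of_diagonal {A : Matrix (Fin m) (Fin m) (lp V 2 →L[ℂ] lp V 2)}
    {T : ∀ p, Matrix (Fin m) (Fin m) (V p →L[ℂ] V p)}
    (hA : ∀ i j x p, (A i j x) p = T p i j (x p)) {C : ℝ} (hC : 0 ≤ C)
    (hT : ∀ p, ‖matrixOperator m (V p) (T p)‖ ≤ C) : ‖matrixOperator m (lp V 2) A‖ ≤ C := by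
  refine ContinuousLinearMap.opNorm_le_bound _ hC fun x => ?_
  refine abs_le_of_sq_le_sq' ?_ (by positivity) |>.2
  rw [mul_pow]
  refine hasSum_le (fun p => ?_) (hasSum_norm_sq_piLp_lp _)
    ((hasSum_norm_sq_piLp_lp x).mul_left (C ^ 2))
  rw [← mul_pow]
  gcongr
  refine le_trans (le_of_eq ?_) ((matrixOperator m (V p) (T p)).le_of_opNorm_le (hT p) _)
  congr 1
  ext i
  exact matrixOperator_diagonal_apply hA x p i

theorem norm_matrixOperator_apply_le_of_diagonal
    {A : Matrix (Fin m) (Fin m) (lp V 2 →L[ℂ] lp V 2)}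
    {T : ∀ p, Matrix (Fin m) (Fin m) (V p →L[ℂ] V p)}
    (hA : ∀ i j x p, (A i j x) p = T p i j (x p)) (p : ι) :
    ‖matrixOperator m (V p) (T p)‖ ≤ ‖matrixOperator m (lp V 2) A‖ := by
  classical
  refine ContinuousLinearMap.opNorm_le_bound _ (norm_nonneg _) fun v => ?_
  -- The block at `p` is seen on vectors supported at the coordinate `p`.
  let x : PiLp 2 fun _ : Fin m => lp V 2 := WithLp.toLp 2 fun i => lp.single 2 p (v i)
  calc _ ≤ ‖matrixOperator m (lp V 2) A x‖ := PiLp.norm_le_norm_of_forall fun i => by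
        refine le_trans (le_of_eq ?_) (lp.norm_apply_le_norm two_ne_zero _ p)
        rw [matrixOperator_diagonal_apply hA]
        simp [x]
    _ ≤ _ := (ContinuousLinearMap.le_opNorm _ _).trans (by
        gcongr
        exact PiLp.norm_le_norm_of_forall fun i => by simp [x, lp.norm_single])

end Diagonal

/-! ### Spans of kernel functions -/

section KernelSpan

/-- The functions `s ↦ 1 / (1 - t i * s)` are linearly independent for distinct nonzero `t i`. -/
theorem eq_zero_of_sum_mul_inv_one_sub_eq_zero {n : ℕ} {t : Fin n → ℂ}
    (ht : Function.Injective t) (ht0 : ∀ i, t i ≠ 0) {c : Fin n → ℂ} {S : Set ℂ}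
    (hS : S.Infinite) (hS1 : ∀ s ∈ S, ∀ i, 1 - t i * s ≠ 0)
    (h : ∀ s ∈ S, ∑ i, c i * (1 - t i * s)⁻¹ = 0) (i : Fin n) : c i = 0 := by
  -- `p` is the numerator of the sum over the common denominator; it vanishes on the infinite set
  -- `S`, so it is zero.
  let p : Polynomial ℂ := ∑ i, Polynomial.C (c i) *
    ∏ j ∈ Finset.univ.erase i, (1 - Polynomial.C (t j) * Polynomial.X)
  have hp : p = 0 := by
    refine Polynomial.eq_zero_of_infinite_isRoot p (hS.mono fun s hs => ?_)
    have h1 := congrArg (· * ∏ j, (1 - t j * s)) (h s hs)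
    simp only [zero_mul, Finset.sum_mul] at h1
    change p.eval s = 0
    rw [← h1]
    simp only [p, Polynomial.eval_finsetSum, Polynomial.eval_mul, Polynomial.eval_C,
      Polynomial.eval_prod, Polynomial.eval_sub, Polynomial.eval_one, Polynomial.eval_X]
    refine Finset.sum_congr rfl fun i _ => ?_
    rw [← Finset.mul_prod_erase _ _ (Finset.mem_univ i), mul_assoc,
      inv_mul_cancel_left₀ (hS1 s hs i)]
  -- At `1 / t i` every term except the `i`-th contains the vanishing factor `1 - t i * X`.
  have h2 := congrArg (Polynomial.eval (t i)⁻¹) hp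
  simp only [p, Polynomial.eval_finsetSum, Polynomial.eval_mul, Polynomial.eval_C,
    Polynomial.eval_prod, Polynomial.eval_sub, Polynomial.eval_one, Polynomial.eval_X,
    Polynomial.eval_zero] at h2
  rw [Finset.sum_eq_single i] at h2
  · refine (mul_eq_zero.1 h2).resolve_right (Finset.prod_ne_zero_iff.2 fun j hj h0 => ?_)
    have h3 : t j = t i := by
      rw [sub_eq_zero, eq_comm, mul_inv_eq_one₀ (ht0 i)] at h0
      exact h0
    exact Finset.ne_of_mem_erase hj (ht h3)
  · intro j _ hj
    rw [Finset.prod_eq_zero (Finset.mem_erase.2 ⟨hj.symm, Finset.mem_univ i⟩), mul_zero]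
    rw [mul_inv_cancel₀ (ht0 i), sub_self]
  · simp

variable {d : ℕ}

/-- The kernel function at a point of the ball. -/
noncomputable def kernelVector (w : unitBall d) : DruryArveson d :=
  RKHS.kerFun (DruryArveson d) w (1 : ℂ)

theorem kernelVector_apply (w z : unitBall d) :
    kernelVector w z = (1 - inner ℂ (w : EuclideanSpace ℂ (Fin d)) (z : EuclideanSpace ℂ _))⁻¹ := by
  rw [kernelVector, RKHS.kerFun_apply, DruryArveson.kernel_eq]
  simp [druryArvesonKernel]

theorem inner_kernelVector (w : unitBall d) (f : DruryArveson d) :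
    inner ℂ (kernelVector w) f = f w := by
  rw [kernelVector, RKHS.kerFun_inner]
  simp

/-- By the reproducing property, pairing with `f` gives `(T f)(w) = φ(w) f(w)`, so the eigenvalue is
the conjugate of `φ(w)`. Hence spans of kernel functions are coinvariant. -/
theorem adjoint_multiplier_kernelVector {T : DruryArveson d →L[ℂ] DruryArveson d}
    (hT : T ∈ multiplierAlgebra d) (w : unitBall d) :
    ∃ c : ℂ, ContinuousLinearMap.adjoint T (kernelVector w) = c • kernelVector w := by
  obtain ⟨φ, hφ⟩ := hT
  refine ⟨starRingEnd ℂ (φ w), ext_inner_right ℂ fun f => ?_⟩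
  rw [ContinuousLinearMap.adjoint_inner_left, inner_smul_left, inner_kernelVector,
    inner_kernelVector, hφ, starRingEnd_self_apply]

/-- The point `s e₁` of the ball. -/
noncomputable def axisPoint (hd : 0 < d) (s : ℂ) (hs : ‖s‖ < 1) : unitBall d :=
  ⟨EuclideanSpace.single ⟨0, hd⟩ s, by simpa using hs⟩

/-- Evaluating a linear relation at the points `s e₁` of the axis gives `∑ c i / (1 - t i s) = 0` on
the unit disc. The parameters are real, so no conjugates appear. -/
theorem linearIndependent_kernelVector_axisPoint (hd : 0 < d) {n : ℕ} {t : Fin n → ℝ}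
    (ht : Function.Injective t) (ht0 : ∀ i, t i ≠ 0) (ht1 : ∀ i, ‖(t i : ℂ)‖ < 1) :
    LinearIndependent ℂ fun i => kernelVector (axisPoint hd (t i : ℂ) (ht1 i)) := by
  rw [Fintype.linearIndependent_iff]
  intro c hc
  have hlt : ∀ i, ∀ s ∈ Metric.ball (0 : ℂ) 1, ‖(t i : ℂ) * s‖ < 1 := fun i s hs => by
    rw [norm_mul]
    exact mul_lt_one_of_nonneg_of_lt_one_left (norm_nonneg _) (ht1 i) (mem_ball_zero_iff.1 hs).le
  refine eq_zero_of_sum_mul_inv_one_sub_eq_zero (t := fun i => (t i : ℂ))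
    (S := Metric.ball (0 : ℂ) 1) (Complex.ofReal_injective.comp ht)
    (fun i => Complex.ofReal_ne_zero.2 (ht0 i)) ?_ (fun s hs i h => ?_) fun s hs => ?_
  · exact infinite_of_mem_nhds 0 (Metric.ball_mem_nhds 0 one_pos)
  · have := hlt i s hs
    rw [← sub_eq_zero.1 h, norm_one] at this
    exact lt_irrefl _ this
  · have h := congrArg (fun f : DruryArveson d =>
      inner ℂ (kernelVector (axisPoint hd s (by simpa using hs))) f) hc
    simp only [inner_sum, inner_smul_right, inner_zero_right] at h
    rw [← h]
    refine Finset.sum_congr rfl fun i _ => ?_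
    rw [inner_kernelVector, kernelVector_apply]
    simp [axisPoint, EuclideanSpace.inner_single_left, mul_comm]

theorem coinvariantGrassmannian_nonempty_of_linearIndependent {n : ℕ} {w : Fin n → unitBall d}
    (hw : LinearIndependent ℂ fun i => kernelVector (w i)) :
    (coinvariantGrassmannian d n).Nonempty := by
  set S := Submodule.span ℂ (Set.range fun i => kernelVector (w i)) with hS
  have : FiniteDimensional ℂ S := FiniteDimensional.span_of_finite ℂ (Set.finite_range _)
  have hstar := isStarProjection_starProjection (U := S)
  refine ⟨S.starProjection, hstar.isIdempotentElem, hstar.isSelfAdjoint, fun T hT => ?_, ?_⟩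
  · have hinv : ∀ v ∈ S, ContinuousLinearMap.adjoint T v ∈ S := by
      intro v hv
      induction hv using Submodule.span_induction with
      | mem x hx =>
        obtain ⟨i, rfl⟩ := hx
        obtain ⟨c, hc⟩ := adjoint_multiplier_kernelVector hT (w i)
        simp only [hc]
        exact S.smul_mem c (Submodule.subset_span ⟨i, rfl⟩)
      | zero => simp
      | add x y _ _ hx hy => rw [map_add]; exact S.add_mem hx hy
      | smul c x _ hx => rw [map_smul]; exact S.smul_mem c hx
    refine ContinuousLinearMap.ext fun h => ?_
    exact Submodule.starProjection_eq_self_iff.2 (hinv _ (S.starProjection_apply_mem h))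
  · have h1 : Module.finrank ℂ S = n := by
      rw [hS, finrank_span_eq_card hw, Fintype.card_fin]
    rw [Submodule.range_starProjection, ← Module.finrank_eq_rank, h1]

theorem nonempty_coinvariantGrassmannian (hd : 0 < d) (n : ℕ) :
    Nonempty (coinvariantGrassmannian d n) := by
  -- The points are `1 / (i + 2)`; the shift by `2` keeps the first one, at `i = 0`, inside the open
  -- ball.
  have hpos : ∀ i : Fin n, (0 : ℝ) < (i : ℝ) + 2 := fun i => by positivity
  have hlt : ∀ i : Fin n, ‖((((i : ℝ) + 2)⁻¹ : ℝ) : ℂ)‖ < 1 := fun i => by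
    rw [Complex.norm_real, Real.norm_of_nonneg (inv_pos.2 (hpos i)).le]
    exact inv_lt_one_of_one_lt₀ (by linarith [(Nat.cast_nonneg i : (0 : ℝ) ≤ (i : ℕ))])
  refine (coinvariantGrassmannian_nonempty_of_linearIndependent
    (linearIndependent_kernelVector_axisPoint hd (t := fun i : Fin n => ((i : ℝ) + 2)⁻¹)
      (fun i j hij => ?_) (fun i => (inv_pos.2 (hpos i)).ne') hlt)).to_subtype
  have h := inv_injective hij
  exact Fin.ext (by exact_mod_cast add_right_cancel h)

end KernelSpan

/-! ### The bundles of compressed multipliers -/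

section MultiplierBundle

variable {d n m : ℕ}

theorem norm_toTautologicalFibre_le (P : coinvariantGrassmannian d n) (h : DruryArveson d) :
    ‖toTautologicalFibre P h‖ ≤ ‖h‖ := by
  have hP : IsStarProjection P.1 := ⟨P.2.1, P.2.2.1⟩
  obtain ⟨U, _, hU⟩ := isStarProjection_iff_eq_starProjection.1 hP
  change ‖P.1 h‖ ≤ ‖h‖
  rw [hU]
  exact U.norm_starProjection_apply_le h

/-- This replaces the varying space `(P H²_d)^m` by the fixed space `(H²_d)^m`, where dependence on
`P` is norm continuous. -/
theorem norm_matrixOperator_compression (P : coinvariantGrassmannian d n)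
    (T : Matrix (Fin m) (Fin m) (DruryArveson d →L[ℂ] DruryArveson d)) :
    ‖matrixOperator m (TautologicalFibre P) (T.map (compression P))‖ =
      ‖matrixOperator m (DruryArveson d) (Matrix.of fun i j => P.1 ∘L T i j ∘L P.1)‖ :=
  (norm_matrixOperator_conj
    (LinearMap.range (P.1 : DruryArveson d →ₗ[ℂ] DruryArveson d)).subtypeL
    (toTautologicalFibre P) (fun _ => rfl) (norm_toTautologicalFibre_le P)
    (toTautologicalFibre_coe P) (T.map (compression P))).symm

theorem continuous_norm_matrixOperator_compression
    (T : Matrix (Fin m) (Fin m) (DruryArveson d →L[ℂ] DruryArveson d)) :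
    Continuous fun P : coinvariantGrassmannian d n =>
      ‖matrixOperator m (TautologicalFibre P) (T.map (compression P))‖ := by
  simp only [norm_matrixOperator_compression]
  refine (continuous_matrixOperator.comp (continuous_pi fun i => continuous_pi fun j => ?_)).norm
  exact continuous_subtype_val.clm_comp (continuous_const.clm_comp continuous_subtype_val)

theorem continuous_norm_compression (T : DruryArveson d →L[ℂ] DruryArveson d) :
    Continuous fun P : coinvariantGrassmannian d n => ‖compression P T‖ := by
  have h := continuous_norm_matrixOperator_compression (d := d) (n := n)
    (Matrix.of fun _ _ : Fin 1 => T)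
  exact h.congr fun P => norm_matrixOperator_one (compression P T)

theorem norm_compression_le (P : coinvariantGrassmannian d n)
    (T : DruryArveson d →L[ℂ] DruryArveson d) : ‖compression P T‖ ≤ ‖T‖ :=
  ContinuousLinearMap.opNorm_le_bound _ (norm_nonneg _) fun _ =>
    (norm_toTautologicalFibre_le P _).trans (T.le_opNorm _)

/-- The inclusion of `P 𝓜_d|_{P H²_d}` into the operators on `P H²_d`. -/
noncomputable def multiplierFibreVal (P : coinvariantGrassmannian d n) :
    MultiplierFibre P →ₐ[ℂ] (TautologicalFibre P →L[ℂ] TautologicalFibre P) :=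
  (compressionHom P).range.val

/-- The inclusion of `(I_m ⊗ P) M_m(𝓜_d)|_{ℂ^m ⊗ P H²_d}` into the operators on
`ℂ^m ⊗ P H²_d`. -/
noncomputable def amplifiedFibreVal (m : ℕ) (P : coinvariantGrassmannian d n) :
    AmplifiedFibre m P →ₐ[ℂ] (PiLp 2 (fun _ : Fin m => TautologicalFibre P) →L[ℂ]
      PiLp 2 (fun _ : Fin m => TautologicalFibre P)) :=
  ((matrixOperator m (TautologicalFibre P)).comp (compressionHom P).mapMatrix).range.val

theorem multiplierFibreVal_injective (P : coinvariantGrassmannian d n) :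
    Function.Injective (multiplierFibreVal P) := Subtype.val_injective

theorem amplifiedFibreVal_injective (P : coinvariantGrassmannian d n) :
    Function.Injective (amplifiedFibreVal m P) := Subtype.val_injective

theorem multiplierFibreVal_section (P : coinvariantGrassmannian d n) (f : multiplierAlgebra d) :
    multiplierFibreVal P (multiplierSection n f P) = compressionHom P f := rfl

theorem amplifiedFibreVal_section (P : coinvariantGrassmannian d n)
    (f : Matrix (Fin m) (Fin m) (multiplierAlgebra d)) :
    amplifiedFibreVal m P (amplifiedMultiplierSection n f P) =
      matrixOperator m (TautologicalFibre P) ((compressionHom P).mapMatrix f) := rfl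

theorem amplifiedFibreVal_matrixSection
    (X : Matrix (Fin m) (Fin m) (∀ P, multiplierBundle d n P)) (P : coinvariantGrassmannian d n) :
    amplifiedFibreVal m P (matrixSection X P) =
      matrixOperator m (TautologicalFibre P)
        (Matrix.of fun i j => multiplierFibreVal P (X i j P)) := rfl

instance (P : coinvariantGrassmannian d n) : CompleteSpace (MultiplierFibre P) :=
  have : FiniteDimensional ℂ (MultiplierFibre P) := Module.Finite.of_injective
    (multiplierFibreVal P).toLinearMap (multiplierFibreVal_injective P)
  FiniteDimensional.complete ℂ _

instance (P : coinvariantGrassmannian d n) : CompleteSpace (AmplifiedFibre m P) :=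
  have : FiniteDimensional ℂ (AmplifiedFibre m P) := Module.Finite.of_injective
    (amplifiedFibreVal m P).toLinearMap (amplifiedFibreVal_injective P)
  FiniteDimensional.complete ℂ _

theorem isGeneratingFamily_multiplierSection (d n : ℕ) :
    IsGeneratingFamily (Set.range (multiplierSection (d := d) n)) where
  exists_eq P := by
    rintro ⟨_, f, rfl⟩
    exact ⟨_, ⟨f, rfl⟩, rfl⟩
  add_mem := by
    rintro _ ⟨f, rfl⟩ _ ⟨g, rfl⟩
    refine ⟨f + g, funext fun P => multiplierFibreVal_injective P ?_⟩
    rw [Pi.add_apply, map_add]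
    exact map_add (compressionHom P) f g
  smul_mem := by
    rintro c _ ⟨f, rfl⟩
    refine ⟨c • f, funext fun P => multiplierFibreVal_injective P ?_⟩
    rw [Pi.smul_apply, map_smul]
    exact map_smul (compressionHom P) c f
  continuous_norm := by
    rintro _ ⟨f, rfl⟩
    exact continuous_norm_compression f.1

theorem isGeneratingFamily_amplifiedMultiplierSection (m d n : ℕ) :
    IsGeneratingFamily (Set.range (amplifiedMultiplierSection (m := m) (d := d) n)) where
  exists_eq P := by
    rintro ⟨_, f, rfl⟩
    exact ⟨_, ⟨f, rfl⟩, rfl⟩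
  add_mem := by
    rintro _ ⟨f, rfl⟩ _ ⟨g, rfl⟩
    refine ⟨f + g, funext fun P => amplifiedFibreVal_injective P ?_⟩
    rw [Pi.add_apply, map_add, amplifiedFibreVal_section, map_add, map_add]
    rfl
  smul_mem := by
    rintro c _ ⟨f, rfl⟩
    refine ⟨c • f, funext fun P => amplifiedFibreVal_injective P ?_⟩
    rw [Pi.smul_apply, map_smul, amplifiedFibreVal_section, map_smul, map_smul]
    rfl
  continuous_norm := by
    rintro _ ⟨f, rfl⟩
    exact continuous_norm_matrixOperator_compression (f.map Subtype.val)

/-- Closure under products is `γ_f γ_g = γ_{fg}`, which is where coinvariance enters, through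
`compressionHom`. -/
theorem multiplierBundle_isBanachAlgebraBundle (d n : ℕ) :
    IsBanachAlgebraBundle Unit (multiplierBundle d n) := by
  refine (isGeneratingFamily_multiplierSection d n).isBanachAlgebraBundle ?_
  rintro _ ⟨f, rfl⟩ _ ⟨g, rfl⟩
  refine ⟨f * g, funext fun P => multiplierFibreVal_injective P ?_⟩
  rw [Pi.mul_apply, map_mul]
  exact map_mul (compressionHom P) f g

theorem amplifiedBundle_isBanachAlgebraBundle (m d n : ℕ) :
    IsBanachAlgebraBundle Unit (amplifiedBundle m d n) := by
  refine (isGeneratingFamily_amplifiedMultiplierSection m d n).isBanachAlgebraBundle ?_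
  rintro _ ⟨f, rfl⟩ _ ⟨g, rfl⟩
  refine ⟨f * g, funext fun P => amplifiedFibreVal_injective P ?_⟩
  rw [Pi.mul_apply, map_mul, amplifiedFibreVal_section, map_mul, map_mul]
  rfl

theorem isContinuousSection_multiplierSection (f : multiplierAlgebra d) :
    IsContinuousSection Unit (multiplierBundle d n) (multiplierSection n f) :=
  (isGeneratingFamily_multiplierSection d n).continuous_section ⟨f, rfl⟩

theorem isContinuousSection_amplifiedMultiplierSection
    (f : Matrix (Fin m) (Fin m) (multiplierAlgebra d)) :
    IsContinuousSection Unit (amplifiedBundle m d n) (amplifiedMultiplierSection n f) :=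
  (isGeneratingFamily_amplifiedMultiplierSection m d n).continuous_section ⟨f, rfl⟩

theorem norm_le_norm_matrixSection (X : Matrix (Fin m) (Fin m) (∀ P, multiplierBundle d n P))
    (P : coinvariantGrassmannian d n) (i j : Fin m) : ‖X i j P‖ ≤ ‖matrixSection X P‖ :=
  norm_entry_le_norm_matrixOperator (Matrix.of fun i j => multiplierFibreVal P (X i j P)) i j

theorem norm_matrixSection_le_sum (X : Matrix (Fin m) (Fin m) (∀ P, multiplierBundle d n P))
    (P : coinvariantGrassmannian d n) : ‖matrixSection X P‖ ≤ ∑ i, ∑ j, ‖X i j P‖ :=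
  norm_matrixOperator_le_sum (Matrix.of fun i j => multiplierFibreVal P (X i j P))

theorem norm_matrixSection_one (x : ∀ P, multiplierBundle d n P)
    (P : coinvariantGrassmannian d n) :
    ‖matrixSection (Matrix.of fun _ _ : Fin 1 => x) P‖ = ‖x P‖ :=
  norm_matrixOperator_one (multiplierFibreVal P (x P))

theorem matrixSection_multiplierSection (f : Matrix (Fin m) (Fin m) (multiplierAlgebra d)) :
    matrixSection (f.map (multiplierSection n)) = amplifiedMultiplierSection n f := rfl

theorem matrixSection_sub (X Y : Matrix (Fin m) (Fin m) (∀ P, multiplierBundle d n P)) :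
    matrixSection (X - Y) = matrixSection X - matrixSection Y := by
  refine funext fun P => amplifiedFibreVal_injective P ?_
  rw [Pi.sub_apply, map_sub, amplifiedFibreVal_matrixSection, amplifiedFibreVal_matrixSection,
    amplifiedFibreVal_matrixSection, ← map_sub]
  refine congrArg _ (Matrix.ext fun i j => ?_)
  exact map_sub (multiplierFibreVal P) _ _

/-- A matrix of multipliers is chosen at each `P` separately, with no regularity in `P`; continuity
of the entries is recovered from `isContinuousSection_matrixSection_iff`. -/
theorem exists_eq_matrixSection (Y : ∀ P, amplifiedBundle m d n P) :
    ∃ X : Matrix (Fin m) (Fin m) (∀ P, multiplierBundle d n P), Y = matrixSection X := by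
  choose f hf using fun P => (Y P).2
  exact ⟨Matrix.of fun i j P => multiplierSection n (f P i j) P,
    funext fun P => amplifiedFibreVal_injective P (hf P).symm⟩

/-- Fix `P` and multipliers `f i j` whose sections agree with `X i j` at `P`. Continuity at `P`
means that the distance to these sections tends to `0`, and the distance for matrices is equivalent
to the distances for entries. -/
theorem isContinuousSection_matrixSection_iff
    {X : Matrix (Fin m) (Fin m) (∀ P, multiplierBundle d n P)} :
    IsContinuousSection Unit (amplifiedBundle m d n) (matrixSection X) ↔
      ∀ i j, IsContinuousSection Unit (multiplierBundle d n) (X i j) := by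
  have hg := isGeneratingFamily_multiplierSection d n
  have hga := isGeneratingFamily_amplifiedMultiplierSection m d n
  have hat : ∀ P, ContinuousAt (fun Q => (⟨Q, matrixSection X Q⟩ :
      TotalSpace Unit (amplifiedBundle m d n))) P ↔ ∀ i j, ContinuousAt (fun Q =>
        (⟨Q, X i j Q⟩ : TotalSpace Unit (multiplierBundle d n))) P := by
    intro P
    have hex : ∀ i j, ∃ f, multiplierSection n f P = X i j P := fun i j => by
      obtain ⟨_, ⟨f, rfl⟩, hf⟩ := hg.exists_eq P (X i j P)
      exact ⟨f, hf⟩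
    choose f hf using hex
    have hfP : amplifiedMultiplierSection n (Matrix.of f) P = matrixSection X P := by
      refine amplifiedFibreVal_injective P (congrArg (matrixOperator m _)
        (Matrix.ext fun i j => ?_))
      exact congrArg (multiplierFibreVal P) (hf i j)
    rw [hga.continuousAt_section_iff ⟨_, rfl⟩ hfP]
    have hij : ∀ i j, ContinuousAt (fun Q => (⟨Q, X i j Q⟩ :
        TotalSpace Unit (multiplierBundle d n))) P ↔
          Tendsto (fun Q => ‖X i j Q - multiplierSection n (f i j) Q‖) (𝓝 P) (𝓝 0) :=
      fun i j => hg.continuousAt_section_iff ⟨_, rfl⟩ (hf i j)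
    simp only [hij, ← matrixSection_multiplierSection]
    have hsub : ∀ Q, matrixSection X Q - matrixSection ((Matrix.of f).map (multiplierSection n)) Q
        = matrixSection (X - (Matrix.of f).map (multiplierSection n)) Q := fun Q => by
      rw [matrixSection_sub, Pi.sub_apply]
    simp only [hsub]
    refine ⟨fun h i j => squeeze_zero (fun _ => norm_nonneg _) (fun Q => ?_) h, fun h => ?_⟩
    · exact norm_le_norm_matrixSection (X - (Matrix.of f).map (multiplierSection n)) Q i j
    · refine squeeze_zero (fun _ => norm_nonneg _) (norm_matrixSection_le_sum _) ?_
      have h0 : (0 : ℝ) = ∑ _i : Fin m, ∑ _j : Fin m, 0 := by simp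
      rw [h0]
      exact tendsto_finsetSum _ fun i _ => tendsto_finsetSum _ fun j _ => h i j
  simp only [IsContinuousSection, continuous_iff_continuousAt, hat]
  exact ⟨fun h i j P => h P i j, fun h P i j => h i j P⟩

theorem isBoundedSection_matrixSection_iff
    {X : Matrix (Fin m) (Fin m) (∀ P, multiplierBundle d n P)} :
    IsBoundedSection (matrixSection X) ↔ ∀ i j, IsBoundedSection (X i j) := by
  refine ⟨fun ⟨C, hC⟩ i j => ⟨C, fun P => (norm_le_norm_matrixSection X P i j).trans (hC P)⟩,
    fun h => ?_⟩
  choose C hC using h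
  exact ⟨∑ i, ∑ j, C i j, fun P => (norm_matrixSection_le_sum X P).trans
    (Finset.sum_le_sum fun i _ => Finset.sum_le_sum fun j _ => hC i j P)⟩

end MultiplierBundle

/-! ### The operator algebra of bounded continuous sections -/

section Representation

theorem ContinuousLinearMap.norm_smul_eq {E : Type*} [NormedAddCommGroup E] [NormedSpace ℂ E]
    (c : ℂ) (T : E →L[ℂ] E) : ‖c • T‖ = ‖c‖ * ‖T‖ :=
  norm_smul c T

/-- A closed unital algebra of operators, with the operator norms on matrices, satisfies the axioms
of an abstract operator algebra. -/
theorem IsAbstractOperatorAlgebra.of_representation {A K : Type*} [Ring A] [Algebra ℂ A]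
    [NormedAddCommGroup K] [InnerProductSpace ℂ K] [CompleteSpace K] [Nontrivial K]
    (ρ : A →ₐ[ℂ] (K →L[ℂ] K)) (hρ : Function.Injective ρ) (hclosed : IsClosed (Set.range ρ))
    {N : ∀ m : ℕ, Matrix (Fin m) (Fin m) A → ℝ}
    (hN : ∀ m X, ‖matrixOperator m K (X.map ρ)‖ = N m X) : IsAbstractOperatorAlgebra A N := by
  have hN1 : ∀ a : A, N 1 (Matrix.of fun _ _ => a) = ‖ρ a‖ := fun a => by
    rw [← hN]
    exact norm_matrixOperator_one (ρ a)
  have hmap : ∀ (m k : ℕ) (α : Matrix (Fin m) (Fin k) ℂ), (α.map (algebraMap ℂ A)).map ρ =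
      α.map (algebraMap ℂ (K →L[ℂ] K)) := fun m k α => by
    ext1 i j
    simp
  refine ⟨fun m X => ?_, fun m X => ?_, fun m X Y => ?_, fun m c X => ?_, fun u hu => ?_,
    fun m k X Y => ?_, fun m k α X β => ?_, fun m X Y => ?_, ?_⟩
  · rw [← hN]
    exact norm_nonneg _
  · rw [← hN, norm_eq_zero, map_eq_zero_iff _ matrixOperator_injective]
    refine ⟨fun h => ?_, fun h => ?_⟩
    · ext i j
      exact hρ ((congrFun (congrFun h i) j).trans (map_zero ρ).symm)
    · rw [h]
      exact Matrix.map_zero _ (map_zero ρ)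
  · rw [← hN, ← hN, ← hN, Matrix.map_add _ (map_add ρ), map_add]
    exact norm_add_le _ _
  · rw [← hN, ← hN, Matrix.map_smul _ _ (map_smul ρ c), map_smul]
    exact ContinuousLinearMap.norm_smul_eq c _
  -- The level-one norm is `‖ρ a‖`, so completeness follows from that of the operators on `K` and
  -- the closed range.
  · have hcau : CauchySeq fun k => ρ (u k) := by
      refine Metric.cauchySeq_iff.2 fun ε hε => ?_
      obtain ⟨k₀, hk⟩ := hu ε hε
      refine ⟨k₀, fun k hk' l hl' => ?_⟩
      rw [dist_eq_norm, ← map_sub, ← hN1]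
      exact hk k hk' l hl'
    obtain ⟨T, hT⟩ := cauchySeq_tendsto_of_complete hcau
    obtain ⟨a, rfl⟩ := hclosed.mem_of_tendsto hT (Eventually.of_forall fun k => ⟨u k, rfl⟩)
    refine ⟨a, fun ε hε => ?_⟩
    obtain ⟨k₀, hk⟩ := Metric.tendsto_atTop.1 hT ε hε
    refine ⟨k₀, fun k hk' => ?_⟩
    rw [hN1, map_sub, ← dist_eq_norm]
    exact hk k hk'
  · rw [← hN, ← hN, ← hN, ← norm_matrixOperator_directSum]
    congr 2
    rw [Matrix.reindex_apply, Matrix.reindex_apply, ← Matrix.submatrix_map,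
      Matrix.fromBlocks_map, Matrix.map_zero _ (map_zero ρ), Matrix.map_zero _ (map_zero ρ)]
  · rw [← hN, ← hN, Matrix.map_mul, Matrix.map_mul, hmap, hmap]
    exact norm_matrixOperator_scalar_mul_le α _ β
  · rw [← hN, ← hN, ← hN, Matrix.map_mul, map_mul]
    exact norm_mul_le _ _
  · rw [← hN, Matrix.map_one _ (map_zero ρ) (map_one ρ), map_one]
    -- The identity has norm one only on a nonzero space.
    have : Nontrivial (PiLp 2 fun _ : Fin 1 => K) :=
      (WithLp.equiv 2 (Fin 1 → K)).nontrivial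
    exact norm_one

end Representation

/-! ### Bounded continuous sections and their diagonal representation -/

section BoundedSections

variable {d n m : ℕ}

/-- The algebra of bounded continuous sections of `𝔐_{d,n}`. -/
def boundedSections (d n : ℕ) : Subalgebra ℂ (∀ P, multiplierBundle d n P) where
  carrier := {x | IsContinuousSection Unit (multiplierBundle d n) x ∧ IsBoundedSection x}
  mul_mem' := by
    rintro x y ⟨hx, C, hC⟩ ⟨hy, D, hD⟩
    refine ⟨(multiplierBundle_isBanachAlgebraBundle d n).isContinuousSection_mul hx hy,
      C * D, fun P => (norm_mul_le _ _).trans ?_⟩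
    exact mul_le_mul (hC P) (hD P) (norm_nonneg _) ((norm_nonneg _).trans (hC P))
  add_mem' := by
    rintro x y ⟨hx, C, hC⟩ ⟨hy, D, hD⟩
    exact ⟨(multiplierBundle_isBanachAlgebraBundle d n).isContinuousSection_add hx hy,
      C + D, fun P => (norm_add_le _ _).trans (add_le_add (hC P) (hD P))⟩
  algebraMap_mem' c := by
    -- Scalar sections are the `γ_f` of constant multipliers.
    have h : algebraMap ℂ (∀ P, multiplierBundle d n P) c =
        multiplierSection n (algebraMap ℂ (multiplierAlgebra d) c) :=
      funext fun P => multiplierFibreVal_injective P <| by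
        rw [multiplierFibreVal_section, AlgHom.commutes]
        exact AlgHom.commutes (multiplierFibreVal P) c
    rw [h]
    exact ⟨isContinuousSection_multiplierSection _, _, fun P => norm_compression_le P _⟩

theorem mem_boundedSections {x : ∀ P, multiplierBundle d n P} : x ∈ boundedSections d n ↔
    IsContinuousSection Unit (multiplierBundle d n) x ∧ IsBoundedSection x := Iff.rfl

theorem multiplierSection_mem_boundedSections (f : multiplierAlgebra d) :
    multiplierSection n f ∈ boundedSections d n :=
  ⟨isContinuousSection_multiplierSection f, _, fun P => norm_compression_le P _⟩

theorem isContinuousSection_and_isBoundedSection_iff (Y : ∀ P, amplifiedBundle m d n P) :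
    (IsContinuousSection Unit (amplifiedBundle m d n) Y ∧ IsBoundedSection Y) ↔
      ∃ X : Matrix (Fin m) (Fin m) (boundedSections d n),
        Y = matrixSection (X.map Subtype.val) := by
  constructor
  · rintro ⟨hc, hb⟩
    obtain ⟨X, rfl⟩ := exists_eq_matrixSection Y
    exact ⟨Matrix.of fun i j => ⟨X i j, isContinuousSection_matrixSection_iff.1 hc i j,
      isBoundedSection_matrixSection_iff.1 hb i j⟩, rfl⟩
  · rintro ⟨X, rfl⟩
    exact ⟨isContinuousSection_matrixSection_iff.2 fun i j => (X i j).2.1,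
      isBoundedSection_matrixSection_iff.2 fun i j => (X i j).2.2⟩

theorem injective_of_norm_apply_le {K : Type*} [NormedAddCommGroup K] [InnerProductSpace ℂ K]
    {ρ : boundedSections d n →ₐ[ℂ] (K →L[ℂ] K)} (hρ : ∀ x P, ‖x.1 P‖ ≤ ‖ρ x‖) :
    Function.Injective ρ := by
  refine (injective_iff_map_eq_zero _).2 fun x hx => Subtype.ext (funext fun P => ?_)
  have h := hρ x P
  rw [hx, norm_zero] at h
  exact norm_le_zero_iff.1 h

/-- If `ρ (x k)` converges, the `x k` are uniformly Cauchy over all fibres. Their fibrewise limit is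
a uniform limit, hence bounded and continuous, and `hρ'` identifies its image with the limit
operator. -/
theorem isClosed_range_of_norm_eq_sup {K : Type*} [NormedAddCommGroup K] [InnerProductSpace ℂ K]
    {ρ : boundedSections d n →ₐ[ℂ] (K →L[ℂ] K)} (hρ : ∀ x P, ‖x.1 P‖ ≤ ‖ρ x‖)
    (hρ' : ∀ (x : boundedSections d n) (C : ℝ), 0 ≤ C → (∀ P, ‖x.1 P‖ ≤ C) → ‖ρ x‖ ≤ C) :
    IsClosed (Set.range ρ) := by
  refine isClosed_of_closure_subset fun T hT => ?_
  obtain ⟨u, hu, hlim⟩ := mem_closure_iff_seq_limit.1 hT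
  choose x hx using hu
  have hdist : ∀ P k l, ‖(x k).1 P - (x l).1 P‖ ≤ ‖u k - u l‖ := fun P k l => by
    rw [← hx, ← hx, ← map_sub]
    exact hρ (x k - x l) P
  have hcau : ∀ P, CauchySeq fun k => (x k).1 P := fun P => by
    refine Metric.cauchySeq_iff.2 fun ε hε => ?_
    obtain ⟨k₀, hk⟩ := Metric.cauchySeq_iff.1 hlim.cauchySeq ε hε
    refine ⟨k₀, fun k hk' l hl' => ?_⟩
    rw [dist_eq_norm]
    refine (hdist P k l).trans_lt ?_
    rw [← dist_eq_norm]
    exact hk k hk' l hl'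
  choose a ha using fun P => cauchySeq_tendsto_of_complete (hcau P)
  have hle : ∀ k P, ‖(x k).1 P - a P‖ ≤ ‖u k - T‖ := fun k P =>
    le_of_tendsto_of_tendsto' (tendsto_const_nhds.sub (ha P)).norm
      (tendsto_const_nhds.sub hlim).norm (hdist P k)
  have hzero : Tendsto (fun k => ‖u k - T‖) atTop (𝓝 0) :=
    tendsto_iff_norm_sub_tendsto_zero.1 hlim
  have hmem : a ∈ boundedSections d n := by
    refine ⟨(isGeneratingFamily_multiplierSection d n).isContinuousSection_of_uniform_limit
      fun ε hε => ?_, ?_⟩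
    · obtain ⟨k, hk⟩ := (hzero.eventually_lt_const hε).exists
      exact ⟨(x k).1, (x k).2.1, fun P => (hle k P).trans hk.le⟩
    · obtain ⟨C, hC⟩ := (x 0).2.2
      refine ⟨C + ‖u 0 - T‖, fun P => ?_⟩
      have h1 := norm_sub_le ((x 0).1 P) ((x 0).1 P - a P)
      rw [sub_sub_cancel] at h1
      exact h1.trans (add_le_add (hC P) (hle 0 P))
  refine ⟨⟨a, hmem⟩, tendsto_nhds_unique ?_ hlim⟩
  rw [tendsto_iff_norm_sub_tendsto_zero]
  refine squeeze_zero (fun _ => norm_nonneg _) (fun k => ?_) hzero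
  rw [← hx k, ← map_sub, hx k]
  exact hρ' _ _ (norm_nonneg _) (hle k)

/-- The Hilbert sum of all the fibres `P H²_d`. -/
abbrev FibreSum (d n : ℕ) : Type :=
  lp (fun P : coinvariantGrassmannian d n => TautologicalFibre P) 2

instance : CompleteSpace (FibreSum d n) :=
  have : ∀ P : coinvariantGrassmannian d n, CompleteSpace (TautologicalFibre P) :=
    fun _ => FiniteDimensional.complete ℂ _
  lp.completeSpace

theorem exists_norm_multiplierFibreVal_le (x : boundedSections d n) :
    ∃ C : ℝ, 0 ≤ C ∧ ∀ P, ‖multiplierFibreVal P (x.1 P)‖ ≤ C := by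
  obtain ⟨C, hC⟩ := x.2.2
  exact ⟨max C 0, le_max_right _ _, fun P => (hC P).trans (le_max_left _ _)⟩

/-- The diagonal operator on the Hilbert sum of the fibres defined by a bounded section. -/
noncomputable def diagonalOperator (x : boundedSections d n) :
    FibreSum d n →L[ℂ] FibreSum d n :=
  lp.mapCLM 2 (fun P => multiplierFibreVal P (x.1 P))
    (exists_norm_multiplierFibreVal_le x).choose_spec.1
    (exists_norm_multiplierFibreVal_le x).choose_spec.2

theorem diagonalOperator_apply (x : boundedSections d n) (v : FibreSum d n)
    (P : coinvariantGrassmannian d n) :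
    (diagonalOperator x v) P = multiplierFibreVal P (x.1 P) (v P) := rfl

/-- The representation of the bounded sections by diagonal operators. -/
noncomputable def diagonalRepresentation (d n : ℕ) :
    boundedSections d n →ₐ[ℂ] (FibreSum d n →L[ℂ] FibreSum d n) where
  toFun := diagonalOperator
  map_one' := ContinuousLinearMap.ext fun v => lp.ext <| funext fun P => by
    rw [diagonalOperator_apply]
    exact congrArg (· (v P)) (map_one (multiplierFibreVal P))
  map_mul' x y := ContinuousLinearMap.ext fun v => lp.ext <| funext fun P => by
    rw [diagonalOperator_apply]
    exact congrArg (· (v P)) (map_mul (multiplierFibreVal P) (x.1 P) (y.1 P))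
  map_zero' := ContinuousLinearMap.ext fun v => lp.ext <| funext fun P => by
    rw [diagonalOperator_apply]
    exact congrArg (· (v P)) (map_zero (multiplierFibreVal P))
  map_add' x y := ContinuousLinearMap.ext fun v => lp.ext <| funext fun P => by
    rw [diagonalOperator_apply]
    exact congrArg (· (v P)) (map_add (multiplierFibreVal P) (x.1 P) (y.1 P))
  commutes' c := ContinuousLinearMap.ext fun v => lp.ext <| funext fun P => by
    rw [diagonalOperator_apply]
    exact congrArg (· (v P)) (AlgHom.commutes (multiplierFibreVal P) c)

theorem norm_matrixSection_le_norm_diagonal (X : Matrix (Fin m) (Fin m) (boundedSections d n))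
    (P : coinvariantGrassmannian d n) : ‖matrixSection (X.map Subtype.val) P‖ ≤
      ‖matrixOperator m (FibreSum d n) (X.map (diagonalRepresentation d n))‖ :=
  norm_matrixOperator_apply_le_of_diagonal
    (T := fun P => Matrix.of fun i j => multiplierFibreVal P ((X i j).1 P))
    (fun _ _ _ _ => rfl) P

theorem norm_diagonal_le {X : Matrix (Fin m) (Fin m) (boundedSections d n)} {C : ℝ}
    (hC : 0 ≤ C) (h : ∀ P, ‖matrixSection (X.map Subtype.val) P‖ ≤ C) :
    ‖matrixOperator m (FibreSum d n) (X.map (diagonalRepresentation d n))‖ ≤ C :=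
  norm_matrixOperator_le_of_diagonal
    (T := fun P => Matrix.of fun i j => multiplierFibreVal P ((X i j).1 P))
    (fun _ _ _ _ => rfl) hC h

theorem norm_matrixOperator_diagonalRepresentation
    (X : Matrix (Fin m) (Fin m) (boundedSections d n)) :
    ‖matrixOperator m (FibreSum d n) (X.map (diagonalRepresentation d n))‖ =
      supMatrixNorm (X.map Subtype.val) := by
  refine le_antisymm (norm_diagonal_le (Real.iSup_nonneg fun P => norm_nonneg _) fun P => ?_)
    (Real.iSup_le (norm_matrixSection_le_norm_diagonal X) (norm_nonneg _))
  -- A real supremum of an unbounded family is `0` by default, so a bound on the fibre norms is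
  -- required; the norm of the diagonal operator is one.
  refine le_ciSup (f := fun P => ‖matrixSection (X.map Subtype.val) P‖)
    ⟨‖matrixOperator m (FibreSum d n) (X.map (diagonalRepresentation d n))‖, ?_⟩ P
  rintro _ ⟨Q, rfl⟩
  exact norm_matrixSection_le_norm_diagonal X Q

theorem norm_apply_le_norm_diagonal (x : boundedSections d n) (P : coinvariantGrassmannian d n) :
    ‖x.1 P‖ ≤ ‖diagonalRepresentation d n x‖ := by
  rw [← norm_matrixOperator_one (diagonalRepresentation d n x), ← norm_matrixSection_one]
  exact norm_matrixSection_le_norm_diagonal (Matrix.of fun _ _ : Fin 1 => x) P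

theorem norm_diagonalRepresentation_le {x : boundedSections d n} {C : ℝ} (hC : 0 ≤ C)
    (h : ∀ P, ‖x.1 P‖ ≤ C) : ‖diagonalRepresentation d n x‖ ≤ C := by
  rw [← norm_matrixOperator_one (diagonalRepresentation d n x)]
  refine norm_diagonal_le (X := Matrix.of fun _ _ : Fin 1 => x) hC fun P => ?_
  exact (norm_matrixSection_one x.1 P).trans_le (h P)

theorem diagonalRepresentation_injective : Function.Injective (diagonalRepresentation d n) :=
  injective_of_norm_apply_le norm_apply_le_norm_diagonal

theorem isClosed_range_diagonalRepresentation (d n : ℕ) :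
    IsClosed (Set.range (diagonalRepresentation d n)) :=
  isClosed_range_of_norm_eq_sup norm_apply_le_norm_diagonal
    fun _ _ hC h => norm_diagonalRepresentation_le hC h

/-- This serves the norm of the unit: `hd` provides a point of `ℙ_{d,n}`, and `hn` makes its fibre
nonzero. -/
theorem nontrivial_fibreSum (hd : 0 < d) (hn : 0 < n) : Nontrivial (FibreSum d n) := by
  classical
  obtain ⟨P⟩ := nonempty_coinvariantGrassmannian hd n
  have : Nontrivial (TautologicalFibre P) :=
    Module.nontrivial_of_finrank_pos (R := ℂ) (by rwa [finrank_tautologicalFibre])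
  exact (lp.isometry_single (E := fun P : coinvariantGrassmannian d n => TautologicalFibre P)
    (p := 2) P).injective.nontrivial

end BoundedSections

end

open Bundle in
theorem proposition5p1 (d n : ℕ) (hd : 0 < d) (hn : 0 < n) :
    -- the tautological bundle is a Hilbert bundle of rank `n`
    IsHilbertBundle (EuclideanSpace ℂ (Fin n)) (tautologicalBundle d n) ∧
    -- the compressed multipliers form a Banach algebra bundle, whose topology is the only one
    -- making it a Banach bundle with all the sections `γ_f` continuous
    (IsBanachAlgebraBundle Unit (multiplierBundle d n) ∧
      (∀ f, IsContinuousSection Unit (multiplierBundle d n) (multiplierSection n f)) ∧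
      ∀ τ : TopologicalSpace (TotalSpace Unit (multiplierBundle d n)),
        @IsBanachBundle _ _ Unit (multiplierBundle d n) _ _ τ →
        (∀ f, @IsContinuousSection _ _ Unit (multiplierBundle d n) τ (multiplierSection n f)) →
        τ = multiplierTopology d n) ∧
    -- the same for all matrix amplifications
    (∀ m : ℕ, IsBanachAlgebraBundle Unit (amplifiedBundle m d n) ∧
      (∀ f, IsContinuousSection Unit (amplifiedBundle m d n) (amplifiedMultiplierSection n f)) ∧
      ∀ τ : TopologicalSpace (TotalSpace Unit (amplifiedBundle m d n)),
        @IsBanachBundle _ _ Unit (amplifiedBundle m d n) _ _ τ →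
        (∀ f, @IsContinuousSection _ _ Unit (amplifiedBundle m d n) τ
          (amplifiedMultiplierSection n f)) →
        τ = amplifiedTopology m d n) ∧
    -- the continuous sections of the amplifications are the matrices of continuous sections
    (∀ (m : ℕ) (Y : ∀ P, amplifiedBundle m d n P),
      IsContinuousSection Unit (amplifiedBundle m d n) Y ↔
        ∃ X : Matrix (Fin m) (Fin m) (∀ P, multiplierBundle d n P),
          (∀ i j, IsContinuousSection Unit (multiplierBundle d n) (X i j)) ∧
          Y = matrixSection X) ∧
    -- the bounded continuous sections form an operator algebra
    ∃ Γb : Subalgebra ℂ (∀ P, multiplierBundle d n P),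
      (∀ x, x ∈ Γb ↔ IsContinuousSection Unit (multiplierBundle d n) x ∧ IsBoundedSection x) ∧
      (∀ f, multiplierSection n f ∈ Γb) ∧
      -- `M_m(Γb)` consists of the bounded continuous sections of the `m`-th amplification
      (∀ (m : ℕ) (Y : ∀ P, amplifiedBundle m d n P),
        (IsContinuousSection Unit (amplifiedBundle m d n) Y ∧ IsBoundedSection Y) ↔
          ∃ X : Matrix (Fin m) (Fin m) Γb, Y = matrixSection (X.map Subtype.val)) ∧
      -- at the first level the norm is the supremum norm of sections
      (∀ x : Γb, supMatrixNorm (Matrix.of fun _ _ : Fin 1 => x.1) = ⨆ P, ‖x.1 P‖) ∧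
      IsAbstractOperatorAlgebra Γb (fun m X => supMatrixNorm (m := m) (X.map Subtype.val)) ∧
      IsRepresentedOperatorAlgebra Γb (fun m X => supMatrixNorm (m := m) (X.map Subtype.val)) :=
    by
  have hg := isGeneratingFamily_multiplierSection d n
  have := nontrivial_fibreSum hd hn
  have hN : ∀ m (X : Matrix (Fin m) (Fin m) (boundedSections d n)),
      ‖matrixOperator m (FibreSum d n) (X.map (diagonalRepresentation d n))‖ =
        supMatrixNorm (X.map Subtype.val) :=
    fun m X => norm_matrixOperator_diagonalRepresentation X
  refine ⟨tautologicalBundle_isHilbertBundle, ⟨multiplierBundle_isBanachAlgebraBundle d n,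
    isContinuousSection_multiplierSection, fun τ hτ hc =>
      hτ.eq_tubeTopology (Set.forall_mem_range.2 hc) hg.exists_eq⟩,
    fun m => ⟨amplifiedBundle_isBanachAlgebraBundle m d n,
      isContinuousSection_amplifiedMultiplierSection, fun τ hτ hc =>
        hτ.eq_tubeTopology (Set.forall_mem_range.2 hc)
          (isGeneratingFamily_amplifiedMultiplierSection m d n).exists_eq⟩,
    fun m Y => ⟨fun hY => ?_, ?_⟩, boundedSections d n, fun x => mem_boundedSections,
    multiplierSection_mem_boundedSections,
    fun m Y => isContinuousSection_and_isBoundedSection_iff Y,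
    fun x => iSup_congr fun P => norm_matrixSection_one x.1 P,
    .of_representation (diagonalRepresentation d n) diagonalRepresentation_injective
      (isClosed_range_diagonalRepresentation d n) hN,
    FibreSum d n, inferInstance, inferInstance, inferInstance, diagonalRepresentation d n,
    isClosed_range_diagonalRepresentation d n, hN⟩
  · obtain ⟨X, rfl⟩ := exists_eq_matrixSection Y
    exact ⟨X, isContinuousSection_matrixSection_iff.1 hY, rfl⟩
  · rintro ⟨X, hX, rfl⟩
    exact isContinuousSection_matrixSection_iff.2 hX
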